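/- **Theorem 5 (Principle of Minimal Free Energy).** *Setting.* Consider a closed, undriven classical Hamiltonian system consisting of a system with phase space $\Omega_S$ and Hamiltonian $H_S$ and a bath with phase space $\Omega_B$ and Hamiltonian $H_B$ (open subsets of $\mathbb R^{2n}$, $\mathbb R^{2m}$; $C^2$ Hamiltonians), with total Hamiltonian $H=H_S+H_B+V$ on $\Omega_S\times\Omega_B$ and complete flow $U(t)$. Volumes $|\cdot|$ and integrals $d\omega$ refer to the dimensionless Liouville measure $dq\,dp/h^{\text{number of degrees of freedom}}$. The space $\Omega_S$ is partitioned into countably many (Boltzmann) cells $B$ of finite volume; the cells of system plus bath are the sets $C_{B,j}$ on which the system is in $B$ and $E+j\Delta\le H<E+(j+1)\Delta$, $j\in\mathbb Z$, where $\Delta>0$ and every such total energy shell has finite volume. For a cell $A$ put $\rho_A=\chi_A/|A|$, and let $\mathscr C\rho=\sum_A\left(\int_A\rho\,d\omega\right)\rho_A$ be the coarse-graining operator of a partition and $(U(t)\rho)(x)=\rho(U(t)^{-1}x)$. System plus bath starts at time $0$ in $\rho_{C_{A,0}}$ with $|C_{A,0}|>0$. Let $p_t(B)$ be the probability that the system is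 in $B$ at time $t$, let $\tilde\rho(t)=\sum_B p_t(B)\rho_B$ be the coarse-grained macro-state of the system, $E(B)=\int\rho_BH_S\,d\omega$, and let $$F[\tilde\rho,T]=\int_{\Omega_S}\tilde\rho\,\left(H_S+T\log\tilde\rho\right)d\omega$$ be its coarse-grained free energy, $T>0$. The system is *thermostated at temperature $T$ with accuracy $\eta$* if $|V|\le\eta\min(\Delta,T)$; $H_S$ varies by at most $\eta\min(\Delta,T)$ inside each cell; and there is $g>0$ such that, for every cell $B$ with $p_t(B)\neq0$ for some $t\ge0$ and all $e<e'$ in $[E-E(B)-\Delta,\,E-E(B)+2\Delta]$, the volume $|\{e\le H_B<e'\}|$ equals $g\int_e^{e'}e^{s/T}ds$ up to a factor in $[e^{-\eta},e^{\eta}]$ (the entropy of the bath has slope $1/T$). The dynamics is *locally mixing* if $\mathscr C U(t+\tau)\rho_C-\mathscr C U(t)\mathscr C U(\tau)\rho_C\to0$ pointwise as $t,\tau\to\infty$, for every cell $C$ of system plus bath; $\tau_0\ge0$ is a *local mixing time* if these differences vanish for all $t,\tau\ge\tau_0$. *Claim.* For every $\delta>0$ there is $\eta>0$, depending on $\delta$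 only, such that for every system thermostated at a temperature $T$ with accuracy $\eta$, the free energy $F(t)=F[\tilde\rho(t),T]$ is well defined (its integrand is integrable) for $t\ge0$, and: 1. $F(t)\le F(0)+\delta T$ for all $t\ge0$; 2. if $\tau_0$ is a local mixing time, then $F(t+\tau)\le F(\tau)+\delta T$ for all $t,\tau\ge\tau_0$; 3. if the dynamics is locally mixing, then there is $\tau_0\ge0$ such that $F(t+\tau)\le F(\tau)+\delta T$ for all $t,\tau\ge\tau_0$. In other words, up to errors that vanish in the limit of an ideal thermostat, the coarse-grained free energy of a non-driven thermostated system decreases monotonically on time scales beyond the local mixing time. -/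

import Mathlib

open MeasureTheory Filter Topology Set

noncomputable section

/-! ## Phase space, Hamiltonian dynamics -/

/-- Phase space of a mechanical system whose degrees of freedom are labelled by `ι`:
a micro-state is `x = (q, p)`. -/
abbrev Phase (ι : Type*) := (ι → ℝ) × (ι → ℝ)

/-- The dimensionless Liouville measure `dω = dq dp / h ^ (number of degrees of freedom)`. -/
def liouville (ι : Type*) [Fintype ι] (h : ℝ) : Measure (Phase ι) :=
  (ENNReal.ofReal (h ^ Fintype.card ι))⁻¹ • (volume : Measure (Phase ι))

/-- The Hamiltonian vector field `(∂H/∂p, -∂H/∂q)` (no external force). -/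
def hamiltonianField {ι : Type*} [Fintype ι] [DecidableEq ι] (H : Phase ι → ℝ) (x : Phase ι) :
    Phase ι :=
  (fun i => fderiv ℝ H x (0, Pi.single i 1), fun i => -fderiv ℝ H x (Pi.single i 1, 0))

/-- `U` is the (complete) flow of the undriven Hamiltonian equations of `H` on the phase space `Ω`:
`U t x` is the micro-state reached from `x` after a time `t`. -/
structure IsHamiltonianFlow {ι : Type*} [Fintype ι] [DecidableEq ι] (Ω : Set (Phase ι))
    (H : Phase ι → ℝ) (U : ℝ → Phase ι → Phase ι) : Prop where
  mapsTo : ∀ t, MapsTo (U t) Ω Ω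
  zero : ∀ x ∈ Ω, U 0 x = x
  hamilton : ∀ x ∈ Ω, ∀ t, HasDerivAt (fun s => U s x) (hamiltonianField H (U t x)) t
  contDiffOn : ContDiffOn ℝ 1 (fun z : ℝ × Phase ι => U z.1 z.2) (univ ×ˢ Ω)

/-- Evolution of a phase space distribution, `(U(t) ρ)(x) = ρ (U(t)⁻¹ x)`; for an autonomous flow
the inverse of `U t` is `U (-t)`. -/
def evolve {X : Type*} (U : ℝ → X → X) (t : ℝ) (ρ : X → ℝ) : X → ℝ := fun x => ρ (U (-t) x)

/-! ## Boltzmann cells, coarse-graining, free energy, local mixing -/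

section CoarseGraining

variable {X α : Type*} [MeasurableSpace X]

/-- A partition of the phase space `Ω` into Boltzmann cells of finite volume. -/
structure IsCellPartition (ω : Measure X) (Ω : Set X) (cell : α → Set X) : Prop where
  measurable : ∀ a, MeasurableSet (cell a)
  disjoint : Pairwise fun a b => Disjoint (cell a) (cell b)
  iUnion : ⋃ a, cell a = Ω
  finite : ∀ a, ω (cell a) ≠ ⊤

/-- The Boltzmann macro-state `ρ_A = χ_A / |A|`. -/
def boltzmannState (ω : Measure X) (A : Set X) : X → ℝ := A.indicator fun _ => (ω.real A)⁻¹

/-- The probability `p_ρ(A) = ∫_A ρ dω` that the system is in `A`. -/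
def cellProb (ω : Measure X) (ρ : X → ℝ) (A : Set X) : ℝ := ∫ x in A, ρ x ∂ω

/-- The coarse-graining operator `C ρ = ∑_A p_ρ(A) ρ_A`. -/
def coarseGrain (ω : Measure X) (cell : α → Set X) (ρ : X → ℝ) : X → ℝ :=
  fun x => ∑' a, cellProb ω ρ (cell a) * boltzmannState ω (cell a) x

/-- The integrand `ρ (H + T log ρ)` of the free energy. -/
def freeEnergyDensity (H : X → ℝ) (T : ℝ) (ρ : X → ℝ) : X → ℝ :=
  fun x => ρ x * (H x + T * Real.log (ρ x))

/-- The free energy `F[ρ, T] = ∫_Ω ρ (H + T log ρ) dω`. -/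
def freeEnergy (ω : Measure X) (Ω : Set X) (H : X → ℝ) (T : ℝ) (ρ : X → ℝ) : ℝ :=
  ∫ x in Ω, freeEnergyDensity H T ρ x ∂ω

/-- Local mixing: `lim C U(t + τ) C = lim C U(t) C U(τ) C` as `t, τ → ∞`, that is, on each
Boltzmann state the two sides become equal in the limit (pointwise; coarse-grained functions are
constant on cells). -/
def IsLocallyMixing (ω : Measure X) (cell : α → Set X) (U : ℝ → X → X) : Prop :=
  ∀ a x, Tendsto
    (fun s : ℝ × ℝ =>
      coarseGrain ω cell (evolve U (s.1 + s.2) (boltzmannState ω (cell a))) x -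
      coarseGrain ω cell
        (evolve U s.1 (coarseGrain ω cell (evolve U s.2 (boltzmannState ω (cell a))))) x)
    (atTop ×ˢ atTop) (𝓝 0)

/-- `τ₀` is a local mixing time: beyond it the two sides of the local mixing identity agree. -/
def IsLocalMixingTime (ω : Measure X) (cell : α → Set X) (U : ℝ → X → X) (τ₀ : ℝ) : Prop :=
  0 ≤ τ₀ ∧ ∀ a t τ, τ₀ ≤ t → τ₀ ≤ τ →
    coarseGrain ω cell (evolve U (t + τ) (boltzmannState ω (cell a))) =
    coarseGrain ω cell
      (evolve U t (coarseGrain ω cell (evolve U τ (boltzmannState ω (cell a)))))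

end CoarseGraining

/-! ## A system in contact with a bath -/

/-- The system part of a micro-state of system plus bath. -/
def sysPart {ι κ : Type*} (z : Phase (ι ⊕ κ)) : Phase ι :=
  (fun i => z.1 (Sum.inl i), fun i => z.2 (Sum.inl i))

/-- The bath part of a micro-state of system plus bath. -/
def bathPart {ι κ : Type*} (z : Phase (ι ⊕ κ)) : Phase κ :=
  (fun k => z.1 (Sum.inr k), fun k => z.2 (Sum.inr k))

/-- The phase space of system plus bath. -/
def jointSpace {ι κ : Type*} (ΩS : Set (Phase ι)) (ΩB : Set (Phase κ)) : Set (Phase (ι ⊕ κ)) :=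
  {z | sysPart z ∈ ΩS ∧ bathPart z ∈ ΩB}

/-- The total Hamiltonian `H_S + H_B + V`. -/
def jointHamiltonian {ι κ : Type*} (HS : Phase ι → ℝ) (HB : Phase κ → ℝ)
    (V : Phase (ι ⊕ κ) → ℝ) (z : Phase (ι ⊕ κ)) : ℝ :=
  HS (sysPart z) + HB (bathPart z) + V z

/-- A closed, undriven Hamiltonian system made of a system (degrees of freedom `ι`, partitioned
into Boltzmann cells labelled by `α`) and a bath (degrees of freedom `κ`), with interaction `V`.
The values of the total energy are resolved into the shells `[E + j Δ, E + (j + 1) Δ)`, `j ∈ ℤ`. -/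
structure SystemWithBath (ι κ α : Type*) [Fintype ι] [Fintype κ] [DecidableEq ι]
    [DecidableEq κ] where
  /-- unit of phase space volume per degree of freedom -/
  h : ℝ
  h_pos : 0 < h
  /-- phase space of the system -/
  ΩS : Set (Phase ι)
  isOpen_ΩS : IsOpen ΩS
  /-- Hamiltonian of the system -/
  HS : Phase ι → ℝ
  contDiffOn_HS : ContDiffOn ℝ 2 HS ΩS
  /-- Boltzmann cells of the system -/
  cell : α → Set (Phase ι)
  partition : IsCellPartition (liouville ι h) ΩS cell
  /-- phase space of the bath -/
  ΩB : Set (Phase κ)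
  isOpen_ΩB : IsOpen ΩB
  /-- Hamiltonian of the bath -/
  HB : Phase κ → ℝ
  contDiffOn_HB : ContDiffOn ℝ 2 HB ΩB
  /-- interaction between system and bath -/
  V : Phase (ι ⊕ κ) → ℝ
  contDiffOn_V : ContDiffOn ℝ 2 V (jointSpace ΩS ΩB)
  /-- evolution of system plus bath -/
  U : ℝ → Phase (ι ⊕ κ) → Phase (ι ⊕ κ)
  flow : IsHamiltonianFlow (jointSpace ΩS ΩB) (jointHamiltonian HS HB V) U
  /-- total energy -/
  E : ℝ
  /-- thickness of the energy shells -/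
  Δ : ℝ
  Δ_pos : 0 < Δ
  shell_finite : ∀ j : ℤ, liouville (ι ⊕ κ) h {z | z ∈ jointSpace ΩS ΩB ∧
    E + j * Δ ≤ jointHamiltonian HS HB V z ∧ jointHamiltonian HS HB V z < E + (j + 1) * Δ} ≠ ⊤

namespace SystemWithBath

variable {ι κ α : Type*} [Fintype ι] [Fintype κ] [DecidableEq ι] [DecidableEq κ]

/-- Phase space of system plus bath. -/
def Ω (S : SystemWithBath ι κ α) : Set (Phase (ι ⊕ κ)) := jointSpace S.ΩS S.ΩB

/-- Hamiltonian of system plus bath. -/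
def H (S : SystemWithBath ι κ α) : Phase (ι ⊕ κ) → ℝ := jointHamiltonian S.HS S.HB S.V

/-- Liouville measure of system plus bath. -/
def ω (S : SystemWithBath ι κ α) : Measure (Phase (ι ⊕ κ)) := liouville (ι ⊕ κ) S.h

/-- Boltzmann cells of system plus bath; the macroscopic quantities are the total energy and those
of the system. The cell `(B, j)` is the set of joint micro-states such that the system is in `B` and
the total energy is in the shell `j`: up to the interaction and to the spread of `H_S` in `B`, this
is `B ⊗ Ω_B(E + j Δ - E(B))`, where `Ω_B(e)` is the shell `e ≤ H_B < e + Δ` of the bath. -/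
def jointCell (S : SystemWithBath ι κ α) (c : α × ℤ) : Set (Phase (ι ⊕ κ)) :=
  {z | z ∈ S.Ω ∧ sysPart z ∈ S.cell c.1 ∧ S.E + c.2 * S.Δ ≤ S.H z ∧ S.H z < S.E + (c.2 + 1) * S.Δ}

/-- The mean energy `E(B) = ∫ ρ_B H_S dω` of the system in the Boltzmann state `B`. -/
def cellEnergy (S : SystemWithBath ι κ α) (b : α) : ℝ :=
  ∫ x in S.ΩS, boltzmannState (liouville ι S.h) (S.cell b) x * S.HS x ∂(liouville ι S.h)

/-- The fine-grained distribution of system plus bath at time `t`, if at time `0` the system is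
in the Boltzmann state `a` and the total energy is in `[E, E + Δ)`. -/
def fineState (S : SystemWithBath ι κ α) (a : α) (t : ℝ) : Phase (ι ⊕ κ) → ℝ :=
  evolve S.U t (boltzmannState S.ω (S.jointCell (a, 0)))

/-- The probability that the system is in the Boltzmann state `b` at time `t`. -/
def sysProb (S : SystemWithBath ι κ α) (a : α) (t : ℝ) (b : α) : ℝ :=
  cellProb S.ω (S.fineState a t) {z | z ∈ S.Ω ∧ sysPart z ∈ S.cell b}

/-- The coarse-grained macro-state `ρ̃(t) = ∑_B p_t(B) ρ_B` of the system. -/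
def macroState (S : SystemWithBath ι κ α) (a : α) (t : ℝ) : Phase ι → ℝ :=
  fun x => ∑' b, S.sysProb a t b * boltzmannState (liouville ι S.h) (S.cell b) x

/-- The coarse-grained free energy `F[ρ̃(t), T]` of the system. -/
def coarseFreeEnergy (S : SystemWithBath ι κ α) (T : ℝ) (a : α) (t : ℝ) : ℝ :=
  freeEnergy (liouville ι S.h) S.ΩS S.HS T (S.macroState a t)

/-- The bath is a thermostat of temperature `T` for the process starting from the Boltzmann state
`a`, up to the accuracy `η`:
* the interaction is negligible on the scales of `T` and of the width of the energy shells;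
* so is the variation of the energy of the system inside a Boltzmann cell;
* the bath is a heat bath of temperature `T`: the volume of `{H_B ∈ de}` is proportional to
  `exp (e / T) de`, i.e. the entropy of the bath has slope `1 / T`, at the energies that the bath
  has when the system is in one of the Boltzmann states which it visits. -/
structure IsThermostated (S : SystemWithBath ι κ α) (T η : ℝ) (a : α) : Prop where
  weak_interaction : ∀ z ∈ S.Ω, |S.V z| ≤ η * min S.Δ T
  energy_resolved : ∀ b, ∀ x ∈ S.cell b, ∀ y ∈ S.cell b, |S.HS x - S.HS y| ≤ η * min S.Δ T
  heat_bath : ∃ g : ℝ, 0 < g ∧ ∀ b, (∃ t, 0 ≤ t ∧ S.sysProb a t b ≠ 0) → ∀ e e' : ℝ,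
    S.E - S.cellEnergy b - S.Δ ≤ e → e < e' → e' ≤ S.E - S.cellEnergy b + 2 * S.Δ →
    (liouville κ S.h).real {y | y ∈ S.ΩB ∧ e ≤ S.HB y ∧ S.HB y < e'} ∈
      Icc (Real.exp (-η) * (g * ∫ s in e..e', Real.exp (s / T)))
        (Real.exp η * (g * ∫ s in e..e', Real.exp (s / T)))

end SystemWithBath

end

/-! Energy conservation keeps the process in the shell `[E, E + Δ)`, so only the cells with `j = 0`
matter. Let `q b` be the volume of such a cell (`cellVol`), `p b` the probability of `b`, and `f b =
p b / q b` the density of the process on it (`visitDensity`).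

Entropy. The volumes `N b c` carried from cell `b` to cell `c` in time `t` (`transVol`) have row and
column sums `q`: the rows by Liouville's theorem, the columns because the flow preserves the shell.
Jensen's inequality for `x log x` then shows that applying this kernel to a density cannot raise `∑
q f log f` (`negEntropy_le_of_kernel`). The initial state is constant on one cell, so its later
density is exactly the kernel applied to it, and comparison with time `0` needs no mixing. From a
later time `τ` the kernel yields the density of the state re-coarse-grained at `τ`; local mixing
identifies it with the true density at `t + τ`, exactly or in the limit. In the limiting case
dominated convergence passes this on to the entropies.

Free energy. Up to small shifts of the energy bounds, a joint cell is the product of `B` with a bath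
shell at energy `E - E(B)`. Its volume is thus a constant times `|B| exp (-E(B) / T)`, up to a
factor `exp (± 33 η)`. Hence `log (p / |B|) + E(B) / T = log f + K` up to `33 η`, and averaging over
`p` gives `F = T (∑ q f log f + K)` up to `33 η T`, with `K` independent of time
(`exists_abs_coarseFreeEnergy_sub_le`). Monotonicity of the entropy becomes that of `F`. -/

noncomputable section

/-! ## Flows of `C¹` vector fields on an open set -/

section Flow

variable {E : Type*} [NormedAddCommGroup E] [NormedSpace ℝ E]

/-- Two global integral curves of a `C¹` vector field on an open set which agree at one time are
equal. -/
theorem integralCurve_unique {Ω : Set E} (hΩ : IsOpen Ω) {X : E → E} (hX : ContDiffOn ℝ 1 X Ω)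
    {f g : ℝ → E} (hf : ∀ t, HasDerivAt f (X (f t)) t) (hg : ∀ t, HasDerivAt g (X (g t)) t)
    (hfΩ : ∀ t, f t ∈ Ω) {t₀ : ℝ} (h0 : f t₀ = g t₀) : f = g := by
  have hfc : Continuous f := continuous_iff_continuousAt.2 fun t => (hf t).continuousAt
  have hgc : Continuous g := continuous_iff_continuousAt.2 fun t => (hg t).continuousAt
  have hclosed : IsClosed {t | f t = g t} := isClosed_eq hfc hgc
  have hopen : IsOpen {t | f t = g t} := by
    rw [isOpen_iff_mem_nhds]
    intro t ht
    have ht' : f t = g t := ht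
    obtain ⟨K, s, hs, hK⟩ := (hX.contDiffAt (hΩ.mem_nhds (hfΩ t))).exists_lipschitzOnWith
    refine ODE_solution_unique_of_eventually (v := fun _ => X) (s := fun _ => s) (K := K)
      (Eventually.of_forall fun _ => hK) ?_ ?_ ht'
    · filter_upwards [hfc.continuousAt.preimage_mem_nhds hs] with r hr using ⟨hf r, hr⟩
    -- Only `f` is assumed to stay in `Ω`; near a time of agreement, continuity puts `g` in the same
    -- Lipschitz neighbourhood.
    · rw [ht'] at hs
      filter_upwards [hgc.continuousAt.preimage_mem_nhds hs] with r hr using ⟨hg r, hr⟩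
  have huniv := IsClopen.eq_univ ⟨hclosed, hopen⟩ ⟨t₀, h0⟩
  funext t
  exact (huniv ▸ mem_univ t : t ∈ {t | f t = g t})

variable {Ω : Set E} {U : ℝ → E → E}

theorem differentiableAt_flow (hΩ : IsOpen Ω)
    (hU : ContDiffOn ℝ 1 (fun z : ℝ × E => U z.1 z.2) (univ ×ˢ Ω)) (t : ℝ) {x : E} (hx : x ∈ Ω) :
    DifferentiableAt ℝ (U t) x := by
  have h := ((hU.contDiffAt ((isOpen_univ.prod hΩ).mem_nhds (mk_mem_prod (mem_univ t) hx))
    ).differentiableAt one_ne_zero).hasFDerivAt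
  exact (h.comp x (hasFDerivAt_prodMk_right t x)).differentiableAt

theorem continuousOn_fderiv_flow_apply (hΩ : IsOpen Ω)
    (hU : ContDiffOn ℝ 1 (fun z : ℝ × E => U z.1 z.2) (univ ×ˢ Ω)) (u : E) :
    ContinuousOn (fun z : ℝ × E => fderiv ℝ (U z.1) z.2 u) (univ ×ˢ Ω) := by
  have hc := (hU.continuousOn_fderiv_of_isOpen (isOpen_univ.prod hΩ) le_rfl).clm_apply
    (continuousOn_const (c := ((0 : ℝ), u)))
  refine hc.congr fun z hz => ?_
  have h := ((hU.contDiffAt ((isOpen_univ.prod hΩ).mem_nhds hz)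
    ).differentiableAt one_ne_zero).hasFDerivAt
  have h' : fderiv ℝ (U z.1) z.2 = _ := 
    (HasFDerivAt.comp (f := fun y => (z.1, y)) z.2 h (hasFDerivAt_prodMk_right z.1 z.2)).fderiv
  rw [h']
  simp

/-- The variational equation of a `C¹` flow of a `C¹` vector field. -/
theorem hasDerivAt_fderiv_flow_apply [CompleteSpace E] (hΩ : IsOpen Ω) {X : E → E}
    (hX : ContDiffOn ℝ 1 X Ω)
    (hU : ContDiffOn ℝ 1 (fun z : ℝ × E => U z.1 z.2) (univ ×ˢ Ω))
    (hmaps : ∀ t, MapsTo (U t) Ω Ω) (hzero : ∀ x ∈ Ω, U 0 x = x)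
    (hder : ∀ x ∈ Ω, ∀ t, HasDerivAt (fun s => U s x) (X (U t x)) t)
    {x : E} (hx : x ∈ Ω) (u : E) (t : ℝ) :
    HasDerivAt (fun s => fderiv ℝ (U s) x u)
      (fderiv ℝ X (U t x) (fderiv ℝ (U t) x u)) t := by
  -- The flow is only `C¹`, so time and space derivatives are not interchanged directly. Instead the
  -- integral equation `U t y = y + ∫ X (U s y)` is differentiated in `r` along `y = x + r • u`;
  -- `F'` is the derivative of its integrand.
  let F' : ℝ → ℝ → E := fun r s =>
    fderiv ℝ X (U s (x + r • u)) (fderiv ℝ (U s) (x + r • u) u)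
  have hline : Continuous fun r : ℝ => x + r • u := by fun_prop
  obtain ⟨ε, hε, hball⟩ : ∃ ε > 0, Metric.closedBall (0 : ℝ) ε ⊆ (fun r : ℝ => x + r • u) ⁻¹' Ω :=
    Metric.nhds_basis_closedBall.mem_iff.1
      ((hΩ.preimage hline).mem_nhds (by simpa using hx))
  have hpair : ContinuousOn (fun z : ℝ × ℝ => (z.1, x + z.2 • u))
      (univ ×ˢ Metric.closedBall (0 : ℝ) ε) := by fun_prop
  have hpairmaps : MapsTo (fun z : ℝ × ℝ => (z.1, x + z.2 • u))
      (univ ×ˢ Metric.closedBall (0 : ℝ) ε) (univ ×ˢ Ω) :=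
    fun z hz => ⟨mem_univ _, hball hz.2⟩
  have hF'cont : ContinuousOn (fun z : ℝ × ℝ => F' z.2 z.1)
      (univ ×ˢ Metric.closedBall (0 : ℝ) ε) := by
    have h1 : ContinuousOn (fun z : ℝ × ℝ => U z.1 (x + z.2 • u))
        (univ ×ˢ Metric.closedBall (0 : ℝ) ε) := hU.continuousOn.comp hpair hpairmaps
    have h2 := (continuousOn_fderiv_flow_apply hΩ hU u).comp hpair hpairmaps
    exact ((hX.continuousOn_fderiv_of_isOpen hΩ le_rfl).comp h1
      fun z hz => hmaps _ (hball hz.2)).clm_apply h2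
  have hsec : ∀ r ∈ Metric.closedBall (0 : ℝ) ε, Continuous (F' r) := by
    intro r hr
    rw [← continuousOn_univ]
    exact hF'cont.comp (f := fun s : ℝ => (s, r)) (by fun_prop) fun s _ => ⟨mem_univ _, hr⟩
  have hXU : ∀ y ∈ Ω, Continuous fun s => X (U s y) := by
    intro y hy
    rw [← continuousOn_univ]
    refine hX.continuousOn.comp (fun s _ => ?_) fun s _ => hmaps s hy
    exact (hder y hy s).continuousAt.continuousWithinAt
  have h0 : (0 : ℝ) ∈ Metric.closedBall (0 : ℝ) ε := Metric.mem_closedBall_self hε.le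
  have hint : ∀ y ∈ Ω, ∀ t, U t y = y + ∫ s in (0 : ℝ)..t, X (U s y) := by
    intro y hy t
    rw [intervalIntegral.integral_eq_sub_of_hasDerivAt (fun s _ => hder y hy s)
      ((hXU y hy).intervalIntegrable _ _), hzero y hy]
    abel
  have key : ∀ t, fderiv ℝ (U t) x u = u + ∫ s in (0 : ℝ)..t, F' 0 s := by
    intro t
    obtain ⟨C, hC⟩ := ((isCompact_uIcc (a := (0 : ℝ)) (b := t)).prod
      (isCompact_closedBall (0 : ℝ) ε)).exists_bound_of_continuousOn
      (hF'cont.mono (prod_mono (subset_univ _) le_rfl))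
    have hpar := (intervalIntegral.hasDerivAt_integral_of_dominated_loc_of_deriv_le
      (μ := volume) (a := 0) (b := t) (F := fun r s => X (U s (x + r • u))) (F' := F')
      (x₀ := (0 : ℝ)) (s := Metric.closedBall (0 : ℝ) ε) (bound := fun _ => C)
      (Metric.closedBall_mem_nhds _ hε)
      (by
        filter_upwards [Metric.closedBall_mem_nhds (0 : ℝ) hε] with r hr
        exact (hXU _ (hball hr)).aestronglyMeasurable)
      ((hXU _ (hball h0)).intervalIntegrable _ _)
      (hsec 0 h0).aestronglyMeasurable
      (Eventually.of_forall fun s hs r hr => hC (s, r) ⟨uIoc_subset_uIcc hs, hr⟩)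
      intervalIntegrable_const
      (Eventually.of_forall fun s hs r hr => by
        have hy := hball hr
        have h1 : HasDerivAt (fun r : ℝ => x + r • u) u r := by
          simpa using ((hasDerivAt_id r).smul_const u).const_add x
        have h2 := (differentiableAt_flow hΩ hU s hy).hasFDerivAt.comp_hasDerivAt r h1
        have h3 := ((hX.contDiffAt (hΩ.mem_nhds (hmaps s hy))).differentiableAt
          one_ne_zero).hasFDerivAt.comp_hasDerivAt r h2
        exact h3)).2
    have hl : HasDerivAt (fun r : ℝ => x + r • u) u 0 := by
      simpa using ((hasDerivAt_id (0 : ℝ)).smul_const u).const_add x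
    have hA : HasDerivAt (fun r : ℝ => U t (x + r • u)) (fderiv ℝ (U t) x u) 0 := by
      have h2 := (differentiableAt_flow hΩ hU t (hball h0)).hasFDerivAt.comp_hasDerivAt 0 hl
      simp only [zero_smul, add_zero] at h2
      exact h2
    have hB := hl.add hpar
    refine hA.unique (hB.congr_of_eventuallyEq ?_)
    filter_upwards [Metric.closedBall_mem_nhds (0 : ℝ) hε] with r hr
    exact hint _ (hball hr) t
  have hfun : (fun s => fderiv ℝ (U s) x u) = fun t => u + ∫ s in (0 : ℝ)..t, F' 0 s :=
    funext key
  rw [hfun]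
  have h := ((hsec 0 h0).integral_hasStrictDerivAt 0 t).hasDerivAt.const_add u
  simpa [F'] using h

end Flow

/-! ## Liouville's theorem -/

section Liouville

variable {ι : Type*} [Fintype ι]

/-- The canonical symplectic form `dq ∧ dp`. -/
def symplecticForm (ι : Type*) [Fintype ι] : Phase ι →L[ℝ] Phase ι →L[ℝ] ℝ :=
  ∑ i, ((((ContinuousLinearMap.proj i).comp (ContinuousLinearMap.fst ℝ (ι → ℝ) (ι → ℝ))) :
      Phase ι →L[ℝ] ℝ).smulRight
        ((ContinuousLinearMap.proj i).comp (ContinuousLinearMap.snd ℝ (ι → ℝ) (ι → ℝ))) -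
    (((ContinuousLinearMap.proj i).comp (ContinuousLinearMap.snd ℝ (ι → ℝ) (ι → ℝ))) :
      Phase ι →L[ℝ] ℝ).smulRight
        ((ContinuousLinearMap.proj i).comp (ContinuousLinearMap.fst ℝ (ι → ℝ) (ι → ℝ))))

theorem symplecticForm_apply (u v : Phase ι) :
    symplecticForm ι u v = ∑ i, (u.1 i * v.2 i - u.2 i * v.1 i) := by
  simp [symplecticForm]

theorem symplecticForm_swap (u v : Phase ι) :
    symplecticForm ι v u = -symplecticForm ι u v := by
  rw [symplecticForm_apply, symplecticForm_apply, ← Finset.sum_neg_distrib]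
  exact Finset.sum_congr rfl fun i _ => by ring

theorem symplecticForm_nondegenerate :
    (ContinuousLinearMap.toBilinForm (symplecticForm ι)).Nondegenerate := by
  classical
  refine LinearMap.BilinForm.Nondegenerate.ofSeparatingLeft fun u hu => ?_
  have hu' : ∀ v, symplecticForm ι u v = 0 := hu
  ext i
  · have := hu' (0, Pi.single i 1)
    simpa [symplecticForm_apply, Pi.single_apply] using this
  · have := hu' (Pi.single i 1, 0)
    simpa [symplecticForm_apply, Pi.single_apply] using this

/-- A linear map which preserves the symplectic form preserves the volume. -/
theorem abs_det_eq_one_of_symplectic (A : Phase ι →L[ℝ] Phase ι)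
    (hA : ∀ u v, symplecticForm ι (A u) (A v) = symplecticForm ι u v) : |A.det| = 1 := by
  classical
  set B : LinearMap.BilinForm ℝ (Phase ι) := ContinuousLinearMap.toBilinForm (symplecticForm ι)
  let b := Module.finBasis ℝ (Phase ι)
  have hB : B.comp (A : Phase ι →ₗ[ℝ] Phase ι) (A : Phase ι →ₗ[ℝ] Phase ι) = B := by
    exact LinearMap.ext fun u => LinearMap.ext fun v => hA u v
  have hne := (LinearMap.BilinForm.nondegenerate_iff_det_ne_zero b).1
    (symplecticForm_nondegenerate (ι := ι))
  -- In matrices `Aᵀ B A = B` with `det B ≠ 0`, so `(det A)² = 1`.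
  have hmat := LinearMap.BilinForm.toMatrix_comp b b B (A : Phase ι →ₗ[ℝ] Phase ι)
    (A : Phase ι →ₗ[ℝ] Phase ι)
  rw [hB] at hmat
  have hdet := congrArg Matrix.det hmat
  rw [Matrix.det_mul, Matrix.det_mul, Matrix.det_transpose, LinearMap.det_toMatrix] at hdet
  change _ = A.det * _ * A.det at hdet
  have hsq : A.det * A.det = 1 := by
    apply mul_right_cancel₀ hne
    change _ = 1 * (LinearMap.BilinForm.toMatrix b B).det
    change _ * (LinearMap.BilinForm.toMatrix b B).det = _
    linarith
  have h2 : |A.det| * |A.det| = 1 := by rw [abs_mul_abs_self, hsq]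
  nlinarith [abs_nonneg A.det]

variable [DecidableEq ι]

/-- This coordinate-free characterization of the field is all that energy conservation and
Liouville's theorem use of Hamilton's equations, apart from smoothness. -/
theorem symplecticForm_hamiltonianField (H : Phase ι → ℝ) (x v : Phase ι) :
    symplecticForm ι (hamiltonianField H x) v = fderiv ℝ H x v := by
  have hv : v = ∑ i, (v.1 i • ((Pi.single i 1, 0) : Phase ι) +
      v.2 i • ((0, Pi.single i 1) : Phase ι)) := by
    ext i <;> simp [Prod.fst_sum, Prod.snd_sum, Finset.sum_apply, Pi.single_apply]
  conv_rhs => rw [hv]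
  rw [map_sum, symplecticForm_apply]
  refine Finset.sum_congr rfl fun i _ => ?_
  rw [map_add, map_smul, map_smul]
  simp only [hamiltonianField, smul_eq_mul]
  ring

theorem contDiffOn_hamiltonianField {Ω : Set (Phase ι)} (hΩ : IsOpen Ω) {H : Phase ι → ℝ}
    (hH : ContDiffOn ℝ 2 H Ω) : ContDiffOn ℝ 1 (hamiltonianField H) Ω := by
  have h := hH.fderiv_of_isOpen hΩ (m := 1) (by norm_num)
  refine ContDiffOn.prodMk (contDiffOn_pi.2 fun i => ?_) (contDiffOn_pi.2 fun i => ?_)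
  · exact h.clm_apply contDiffOn_const
  · exact (h.clm_apply contDiffOn_const).neg

/-- The derivative of a Hamiltonian vector field is an infinitesimally symplectic map. -/
theorem symplecticForm_fderiv_hamiltonianField {Ω : Set (Phase ι)} (hΩ : IsOpen Ω)
    {H : Phase ι → ℝ} (hH : ContDiffOn ℝ 2 H Ω) {x : Phase ι} (hx : x ∈ Ω) (u v : Phase ι) :
    symplecticForm ι (fderiv ℝ (hamiltonianField H) x u) v +
      symplecticForm ι u (fderiv ℝ (hamiltonianField H) x v) = 0 := by
  have hXd : DifferentiableAt ℝ (hamiltonianField H) x :=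
    ((contDiffOn_hamiltonianField hΩ hH).contDiffAt (hΩ.mem_nhds hx)).differentiableAt one_ne_zero
  have hHd : DifferentiableAt ℝ (fderiv ℝ H) x :=
    ((hH.fderiv_of_isOpen hΩ (m := 1) (by norm_num)).contDiffAt
      (hΩ.mem_nhds hx)).differentiableAt one_ne_zero
  -- Differentiating `dH = symplecticForm (hamiltonianField H)` produces the Hessian; its symmetry
  -- against the antisymmetry of the form gives the cancellation.
  have hsecond : ∀ u v, symplecticForm ι (fderiv ℝ (hamiltonianField H) x u) v =
      fderiv ℝ (fderiv ℝ H) x u v := by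
    intro u v
    have h1 : HasFDerivAt (fun y => symplecticForm ι (hamiltonianField H y) v)
        (((symplecticForm ι).flip v).comp (fderiv ℝ (hamiltonianField H) x)) x :=
      ((symplecticForm ι).flip v).hasFDerivAt.comp x hXd.hasFDerivAt
    have h2 : HasFDerivAt (fun y => fderiv ℝ H y v)
        ((ContinuousLinearMap.apply ℝ ℝ v).comp (fderiv ℝ (fderiv ℝ H) x)) x :=
      (ContinuousLinearMap.apply ℝ ℝ v).hasFDerivAt.comp x hHd.hasFDerivAt
    simp_rw [symplecticForm_hamiltonianField] at h1
    exact congrArg (fun L => L u) (h1.unique h2)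
  have hsymm : IsSymmSndFDerivAt ℝ H x :=
    (hH.contDiffAt (hΩ.mem_nhds hx)).isSymmSndFDerivAt (by simp)
  rw [symplecticForm_swap _ u, hsecond, hsecond, hsymm.eq u v]
  ring

namespace IsHamiltonianFlow

variable {Ω : Set (Phase ι)} {H : Phase ι → ℝ} {U : ℝ → Phase ι → Phase ι}

/-- By the variational equation the left side has zero time derivative, and at time `0` the
differential is the identity. -/
theorem symplectic (hU : IsHamiltonianFlow Ω H U) (hΩ : IsOpen Ω) (hH : ContDiffOn ℝ 2 H Ω)
    (t : ℝ) {x : Phase ι} (hx : x ∈ Ω) (u v : Phase ι) :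
    symplecticForm ι (fderiv ℝ (U t) x u) (fderiv ℝ (U t) x v) = symplecticForm ι u v := by
  have hvar := hasDerivAt_fderiv_flow_apply hΩ (contDiffOn_hamiltonianField hΩ hH) hU.contDiffOn
    hU.mapsTo hU.zero hU.hamilton hx
  have hd : ∀ t, HasDerivAt
      (fun s => symplecticForm ι (fderiv ℝ (U s) x u) (fderiv ℝ (U s) x v)) 0 t := by
    intro t
    have h1 := (symplecticForm ι).hasFDerivAt.comp_hasDerivAt t (hvar u t)
    have h := h1.clm_apply (hvar v t)
    refine h.congr_deriv ?_
    exact symplecticForm_fderiv_hamiltonianField hΩ hH (hU.mapsTo t hx) _ _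
  have hconst := is_const_of_deriv_eq_zero (fun s => (hd s).differentiableAt)
    (fun s => (hd s).deriv) t 0
  have hid : fderiv ℝ (U 0) x = ContinuousLinearMap.id ℝ _ := by
    refine ((hasFDerivAt_id x).congr_of_eventuallyEq ?_).fderiv
    filter_upwards [hΩ.mem_nhds hx] with y hy using hU.zero y hy
  simpa [hid] using hconst

/-- The group law is not part of the definition of the flow; it follows from uniqueness of integral
curves, and makes `U (-t)` the inverse of `U t` on `Ω`. -/
theorem comp_eq (hU : IsHamiltonianFlow Ω H U) (hΩ : IsOpen Ω) (hH : ContDiffOn ℝ 2 H Ω)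
    (s t : ℝ) {x : Phase ι} (hx : x ∈ Ω) : U s (U t x) = U (s + t) x := by
  have h := integralCurve_unique hΩ (contDiffOn_hamiltonianField hΩ hH) (t₀ := 0)
    (f := fun s => U s (U t x)) (g := fun s => U (s + t) x)
    (hU.hamilton _ (hU.mapsTo t hx)) (fun s => (hU.hamilton x hx (s + t)).comp_add_const s t)
    (fun s => hU.mapsTo s (hU.mapsTo t hx))
    (by simp [hU.zero _ (hU.mapsTo t hx)])
  exact congrFun h s

theorem neg_left (hU : IsHamiltonianFlow Ω H U) (hΩ : IsOpen Ω) (hH : ContDiffOn ℝ 2 H Ω)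
    (t : ℝ) {x : Phase ι} (hx : x ∈ Ω) : U (-t) (U t x) = x := by
  rw [hU.comp_eq hΩ hH _ _ hx, neg_add_cancel, hU.zero x hx]

/-- Conservation of energy. -/
theorem energy_eq (hU : IsHamiltonianFlow Ω H U) (hΩ : IsOpen Ω) (hH : ContDiffOn ℝ 2 H Ω)
    (t : ℝ) {x : Phase ι} (hx : x ∈ Ω) : H (U t x) = H x := by
  have hd : ∀ t, HasDerivAt (fun s => H (U s x)) 0 t := by
    intro t
    have h := ((hH.contDiffAt (hΩ.mem_nhds (hU.mapsTo t hx))).differentiableAt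
      two_ne_zero).hasFDerivAt.comp_hasDerivAt t (hU.hamilton x hx t)
    refine h.congr_deriv ?_
    rw [← symplecticForm_hamiltonianField]
    have := symplecticForm_swap (hamiltonianField H (U t x)) (hamiltonianField H (U t x))
    linarith
  have := is_const_of_deriv_eq_zero (fun s => (hd s).differentiableAt) (fun s => (hd s).deriv) t 0
  simpa [hU.zero x hx] using this

theorem continuousOn (hU : IsHamiltonianFlow Ω H U) (hΩ : IsOpen Ω) (t : ℝ) :
    ContinuousOn (U t) Ω := fun _ hx =>
  (differentiableAt_flow hΩ hU.contDiffOn t hx).continuousAt.continuousWithinAt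

/-- `U (-t)` is unconstrained outside `Ω`, hence the intersection with `Ω`. -/
theorem inter_preimage_neg_eq_image (hU : IsHamiltonianFlow Ω H U) (hΩ : IsOpen Ω)
    (hH : ContDiffOn ℝ 2 H Ω) (t : ℝ) {A : Set (Phase ι)} (hA : A ⊆ Ω) :
    Ω ∩ U (-t) ⁻¹' A = U t '' A := by
  ext z
  constructor
  · rintro ⟨hz, hzA⟩
    exact ⟨U (-t) z, hzA, by simpa using hU.neg_left hΩ hH (-t) hz⟩
  · rintro ⟨x, hx, rfl⟩
    refine ⟨hU.mapsTo t (hA hx), ?_⟩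
    rw [mem_preimage, hU.neg_left hΩ hH t (hA hx)]
    exact hx

/-- Liouville's theorem. -/
theorem liouville_inter_preimage (hU : IsHamiltonianFlow Ω H U) (hΩ : IsOpen Ω)
    (hH : ContDiffOn ℝ 2 H Ω) (h t : ℝ) {A : Set (Phase ι)} (hA : A ⊆ Ω) (hm : MeasurableSet A) :
    liouville ι h (Ω ∩ U (-t) ⁻¹' A) = liouville ι h A := by
  have hinj : InjOn (U t) A := fun x hx y hy hxy => by
    rw [← hU.neg_left hΩ hH t (hA hx), hxy, hU.neg_left hΩ hH t (hA hy)]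
  have : (volume : Measure (Phase ι)).IsAddHaarMeasure :=
    Measure.prod.instIsAddHaarMeasure volume volume
  have hvol := lintegral_abs_det_fderiv_eq_addHaar_image (volume : Measure (Phase ι)) hm
    (fun x hx => (differentiableAt_flow hΩ hU.contDiffOn t
      (hA hx)).hasFDerivAt.hasFDerivWithinAt) hinj
  rw [setLIntegral_congr_fun (g := fun _ => 1) hm fun x hx => by
    simp [abs_det_eq_one_of_symplectic _ (hU.symplectic hΩ hH t (hA hx))],
    setLIntegral_one] at hvol
  simp only [liouville, Measure.smul_apply]
  rw [hU.inter_preimage_neg_eq_image hΩ hH t hA, ← hvol]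

end IsHamiltonianFlow

end Liouville

/-! ## Entropy of a density on a countable space -/

section RelativeEntropy

variable {α : Type*}

/-- The negative entropy `∑ q f log f` of the distribution with density `f` with respect to `q`. -/
def negEntropy (q f : α → ℝ) : ℝ := ∑' b, q b * (f b * Real.log (f b))

/-- The graph of the convex function `y log y` lies above its tangent at `x`. Summing this against a
kernel is Jensen's inequality. -/
theorem mul_log_ge_tangent {x y : ℝ} (hx : 0 < x) (hy : 0 ≤ y) :
    y * (Real.log x + 1) - x ≤ y * Real.log y := by
  rcases hy.eq_or_lt with rfl | hy
  · simpa using hx.le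
  · have h := Real.log_le_sub_one_of_pos (div_pos hx hy)
    rw [Real.log_div hx.ne' hy.ne'] at h
    have h2 := mul_le_mul_of_nonneg_left h hy.le
    have h3 : y * (x / y - 1) = x - y := by field_simp
    nlinarith

/-- All densities below are bounded, so every entropy series is dominated by a multiple of the
summable weight `q`. -/
theorem exists_bound_mul_log (M : ℝ) : ∃ K, ∀ x ∈ Icc 0 M, |x * Real.log x| ≤ K := by
  simpa using (isCompact_Icc (a := (0 : ℝ)) (b := M)).exists_bound_of_continuousOn
    Real.continuous_mul_log.continuousOn

variable {q : α → ℝ} (hq : ∀ b, 0 ≤ q b) (hqs : Summable q)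

include hq hqs in
theorem summable_mul_of_abs_le {f : α → ℝ} {K : ℝ} (hf : ∀ b, |f b| ≤ K) :
    Summable fun b => q b * f b := by
  refine Summable.of_norm_bounded (hqs.mul_right K) fun b => ?_
  rw [Real.norm_eq_abs, abs_mul, abs_of_nonneg (hq b)]
  exact mul_le_mul_of_nonneg_left (hf b) (hq b)

include hq hqs in
theorem summable_negEntropy {f : α → ℝ} {M : ℝ} (hf : ∀ b, f b ∈ Icc 0 M) :
    Summable fun b => q b * (f b * Real.log (f b)) := by
  obtain ⟨K, hK⟩ := exists_bound_mul_log M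
  exact summable_mul_of_abs_le hq hqs fun b => hK _ (hf b)

include hq hqs in
/-- Entropy does not decrease under a kernel which preserves the reference measure `q`. -/
theorem negEntropy_le_of_kernel {N : α → α → ℝ} (hN : ∀ b c, 0 ≤ N b c)
    (hrow : ∀ b, HasSum (fun c => N b c) (q b)) (hcol : ∀ c, HasSum (fun b => N b c) (q c))
    {f g : α → ℝ} {M : ℝ} (hf : ∀ b, f b ∈ Icc 0 M) (hg : ∀ b, g b ∈ Icc 0 M)
    (hfg : ∀ c, q c * g c = ∑' b, N b c * f b) : negEntropy q g ≤ negEntropy q f := by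
  obtain ⟨K, hK⟩ := exists_bound_mul_log M
  have hNf : ∀ c, Summable fun b => N b c * f b := fun c =>
    summable_mul_of_abs_le (fun b => hN b c) (hcol c).summable (K := M) fun b => by
      rw [abs_of_nonneg (hf b).1]; exact (hf b).2
  have hNφ : ∀ c, Summable fun b => N b c * (f b * Real.log (f b)) := fun c =>
    summable_mul_of_abs_le (fun b => hN b c) (hcol c).summable
      (f := fun b => f b * Real.log (f b)) fun b => hK _ (hf b)
  have hjensen : ∀ c, q c * (g c * Real.log (g c)) ≤
      ∑' b, N b c * (f b * Real.log (f b)) := by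
    intro c
    -- There is no tangent at `g c = 0`, but then every `N b c * f b` vanishes. Otherwise the
    -- tangent at `g c` is summed over `b`.
    rcases (hg c).1.eq_or_lt with h0 | hpos
    · have hz : ∀ b, N b c * f b = 0 := by
        have hs := (hNf c).hasSum
        rw [← hfg, ← h0, mul_zero,
          hasSum_zero_iff_of_nonneg fun b => mul_nonneg (hN b c) (hf b).1] at hs
        exact congrFun hs
      rw [← h0]
      simp [← mul_assoc, hz]
    · have hs : HasSum (fun b => N b c * f b * (Real.log (g c) + 1) - N b c * g c)
          (q c * g c * (Real.log (g c) + 1) - q c * g c) := by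
        rw [hfg]
        refine ((hNf c).hasSum.mul_right _).sub ?_
        rw [← hfg]
        exact (hcol c).mul_right _
      calc q c * (g c * Real.log (g c))
          = q c * g c * (Real.log (g c) + 1) - q c * g c := by ring
        _ ≤ _ := by
          refine hasSum_le (fun b => ?_) hs (hNφ c).hasSum
          have := mul_le_mul_of_nonneg_left (mul_log_ge_tangent hpos (hf b).1) (hN b c)
          rw [mul_sub, ← mul_assoc] at this
          exact this
  have hprod : Summable fun z : α × α => N z.1 z.2 := by
    rw [summable_prod_of_nonneg fun z => hN z.1 z.2]
    exact ⟨fun b => (hrow b).summable, by simpa only [(hrow _).tsum_eq] using hqs⟩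
  have hprodφ : Summable fun z : α × α => N z.1 z.2 * (f z.1 * Real.log (f z.1)) :=
    summable_mul_of_abs_le (q := fun z : α × α => N z.1 z.2) (fun z => hN z.1 z.2) hprod
      (f := fun z => f z.1 * Real.log (f z.1)) fun z => hK _ (hf z.1)
  have hcolsum : Summable fun c => ∑' b, N b c * (f b * Real.log (f b)) :=
    hprodφ.prod_symm.prod
  calc negEntropy q g ≤ ∑' c, ∑' b, N b c * (f b * Real.log (f b)) :=
        (summable_negEntropy hq hqs hg).tsum_le_tsum hjensen hcolsum
    _ = ∑' b, ∑' c, N b c * (f b * Real.log (f b)) :=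
        (Summable.tsum_comm (f := fun b c => N b c * (f b * Real.log (f b))) hprodφ)
    _ = negEntropy q f := by
        refine tsum_congr fun b => ?_
        rw [tsum_mul_right, (hrow b).tsum_eq]

include hq hqs in
/-- Densities which are uniformly bounded and become equal in the limit have the same entropy in
the limit. -/
theorem tendsto_negEntropy_sub {β : Type*} {l : Filter β} {f g : β → α → ℝ} {M : ℝ}
    (hf : ∀ᶠ n in l, ∀ b, f n b ∈ Icc 0 M) (hg : ∀ᶠ n in l, ∀ b, g n b ∈ Icc 0 M)
    (hfg : ∀ b, q b ≠ 0 → Tendsto (fun n => f n b - g n b) l (𝓝 0)) :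
    Tendsto (fun n => negEntropy q (f n) - negEntropy q (g n)) l (𝓝 0) := by
  obtain ⟨K, hK⟩ := exists_bound_mul_log M
  have hlim : Tendsto (fun n => ∑' b, q b *
      (f n b * Real.log (f n b) - g n b * Real.log (g n b))) l (𝓝 (∑' _ : α, (0 : ℝ))) := by
    refine tendsto_tsum_of_dominated_convergence (bound := fun b => q b * (K + K))
      (hqs.mul_right _) (fun b => ?_) ?_
    · by_cases hb : q b = 0
      · simpa [hb] using tendsto_const_nhds
      rw [← mul_zero (q b)]
      refine Tendsto.const_mul _ ?_
      -- Neither `f n b` nor `g n b` need converge by itself, so continuity of `x log x` has to be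
      -- uniform on `[0, M]`.
      have huc := (isCompact_Icc (a := (0 : ℝ)) (b := M)).uniformContinuousOn_of_continuous
        Real.continuous_mul_log.continuousOn
      rw [Metric.uniformContinuousOn_iff] at huc
      rw [Metric.tendsto_nhds]
      intro ε hε
      obtain ⟨δ, hδ, hφ⟩ := huc ε hε
      filter_upwards [hf, hg, Metric.tendsto_nhds.1 (hfg b hb) δ hδ] with n hfn hgn hn
      have := hφ _ (hfn b) _ (hgn b) (by simpa [Real.dist_eq] using hn)
      simpa [Real.dist_eq] using this
    · filter_upwards [hf, hg] with n hfn hgn b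
      rw [Real.norm_eq_abs, abs_mul, abs_of_nonneg (hq b)]
      exact mul_le_mul_of_nonneg_left
        ((abs_sub _ _).trans (add_le_add (hK _ (hfn b)) (hK _ (hgn b)))) (hq b)
  rw [tsum_zero] at hlim
  refine hlim.congr' ?_
  filter_upwards [hf, hg] with n hfn hgn
  rw [negEntropy, negEntropy, ← (summable_negEntropy hq hqs hfn).tsum_sub
    (summable_negEntropy hq hqs hgn)]
  exact tsum_congr fun b => mul_sub _ _ _

end RelativeEntropy

/-! ## Measures of the cells of system plus bath -/

theorem measurableSet_inter_preimage_of_continuousOn {X Y : Type*} [TopologicalSpace X]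
    [MeasurableSpace X] [OpensMeasurableSpace X] [TopologicalSpace Y] [MeasurableSpace Y]
    [BorelSpace Y] {Ω : Set X} (hΩ : MeasurableSet Ω) {f : X → Y} (hf : ContinuousOn f Ω)
    {t : Set Y} (ht : MeasurableSet t) : MeasurableSet (Ω ∩ f ⁻¹' t) := by
  have h := hΩ.subtype_image (hf.domRestrict.measurable ht)
  rwa [domRestrict_eq, preimage_comp, Subtype.image_preimage_coe] at h

theorem hasSum_measureReal_iUnion {X α : Type*} [MeasurableSpace X] [Countable α]
    {μ : Measure X} {s : α → Set X} (hd : Pairwise (Function.onFun Disjoint s))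
    (hs : ∀ a, MeasurableSet (s a)) (hfin : μ (⋃ a, s a) ≠ ⊤) :
    HasSum (fun a => μ.real (s a)) (μ.real (⋃ a, s a)) := by
  have h := measure_iUnion hd hs (μ := μ)
  rw [measureReal_def, h, ENNReal.tsum_toReal_eq fun a => measure_ne_top_of_subset
    (subset_iUnion s a) hfin]
  exact (ENNReal.summable_toReal (h ▸ hfin)).hasSum

section CoarseGraining

variable {X α : Type*} [MeasurableSpace X] {ω : Measure X}

theorem tsum_mul_boltzmannState {cell : α → Set X}
    (hd : Pairwise fun a b => Disjoint (cell a) (cell b)) (p : α → ℝ) {a : α} {x : X}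
    (hx : x ∈ cell a) :
    ∑' b, p b * boltzmannState ω (cell b) x = p a * (ω.real (cell a))⁻¹ := by
  rw [tsum_eq_single a fun b hb => ?_]
  · rw [boltzmannState, indicator_of_mem hx]
  · rw [boltzmannState, indicator_of_notMem fun hxb => (hd hb).le_bot ⟨hxb, hx⟩, mul_zero]

theorem coarseGrain_apply {cell : α → Set X}
    (hd : Pairwise fun a b => Disjoint (cell a) (cell b)) (ρ : X → ℝ) {a : α} {x : X}
    (hx : x ∈ cell a) :
    coarseGrain ω cell ρ x = cellProb ω ρ (cell a) * (ω.real (cell a))⁻¹ :=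
  tsum_mul_boltzmannState hd _ hx

end CoarseGraining

section Parts

variable {ι κ : Type*} [Fintype ι] [Fintype κ]

theorem contDiff_sysPart {n : WithTop ℕ∞} :
    ContDiff ℝ n (sysPart : Phase (ι ⊕ κ) → Phase ι) := by
  unfold sysPart; fun_prop

theorem contDiff_bathPart {n : WithTop ℕ∞} :
    ContDiff ℝ n (bathPart : Phase (ι ⊕ κ) → Phase κ) := by
  unfold bathPart; fun_prop

end Parts

namespace SystemWithBath

variable {ι κ α : Type*} [Fintype ι] [Fintype κ] [DecidableEq ι] [DecidableEq κ]
variable (S : SystemWithBath ι κ α)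

theorem isOpen_Ω : IsOpen S.Ω :=
  (S.isOpen_ΩS.preimage (contDiff_sysPart (n := 0)).continuous).inter
    (S.isOpen_ΩB.preimage (contDiff_bathPart (n := 0)).continuous)

theorem contDiffOn_H : ContDiffOn ℝ 2 S.H S.Ω :=
  ((S.contDiffOn_HS.comp contDiff_sysPart.contDiffOn fun _ hz => hz.1).add
    (S.contDiffOn_HB.comp contDiff_bathPart.contDiffOn fun _ hz => hz.2)).add S.contDiffOn_V

theorem isHamiltonianFlow : IsHamiltonianFlow S.Ω S.H S.U := S.flow

/-- The energy shell `[E, E + Δ)` of system plus bath. -/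
def shell : Set (Phase (ι ⊕ κ)) := S.Ω ∩ S.H ⁻¹' Ico S.E (S.E + S.Δ)

/-- The part of the energy shell on which the system is in the cell `b`. -/
def shellCell (b : α) : Set (Phase (ι ⊕ κ)) := S.jointCell (b, 0)

theorem shellCell_eq (b : α) : S.shellCell b = S.shell ∩ sysPart ⁻¹' S.cell b := by
  ext z
  simp only [shellCell, jointCell, shell, Int.cast_zero, zero_mul, add_zero, zero_add, one_mul,
    mem_ofPred_eq, mem_inter_iff, mem_preimage, mem_Ico]
  tauto

theorem shellCell_subset_shell (b : α) : S.shellCell b ⊆ S.shell := by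
  rw [shellCell_eq]; exact inter_subset_left

theorem shell_subset : S.shell ⊆ S.Ω := inter_subset_left

theorem shellCell_subset (b : α) : S.shellCell b ⊆ S.Ω :=
  (S.shellCell_subset_shell b).trans S.shell_subset

theorem measure_shell_ne_top : S.ω S.shell ≠ ⊤ := by
  have h := S.shell_finite 0
  simp only [Int.cast_zero, zero_mul, add_zero, zero_add, one_mul] at h
  exact h

theorem measurableSet_shell : MeasurableSet S.shell :=
  measurableSet_inter_preimage_of_continuousOn S.isOpen_Ω.measurableSet
    S.contDiffOn_H.continuousOn measurableSet_Ico

theorem measurableSet_shellCell (b : α) : MeasurableSet (S.shellCell b) := by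
  rw [shellCell_eq]
  exact S.measurableSet_shell.inter
    ((contDiff_sysPart (n := 0)).continuous.measurable (S.partition.measurable b))

theorem pairwise_disjoint_jointCell :
    Pairwise fun c d => Disjoint (S.jointCell c) (S.jointCell d) := by
  intro c d hcd
  rw [Set.disjoint_left]
  rintro z ⟨-, hc, hc1, hc2⟩ ⟨-, hd, hd1, hd2⟩
  apply hcd
  have h1 : c.1 = d.1 := by
    by_contra h
    exact (S.partition.disjoint h).le_bot ⟨hc, hd⟩
  have h2 : (c.2 : ℝ) < d.2 + 1 := lt_of_mul_lt_mul_right (by linarith) S.Δ_pos.le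
  have h3 : (d.2 : ℝ) < c.2 + 1 := lt_of_mul_lt_mul_right (by linarith) S.Δ_pos.le
  have h4 : c.2 < d.2 + 1 := by exact_mod_cast h2
  have h5 : d.2 < c.2 + 1 := by exact_mod_cast h3
  exact Prod.ext h1 (by omega)

theorem pairwise_disjoint_shellCell :
    Pairwise fun b c => Disjoint (S.shellCell b) (S.shellCell c) := fun _ _ h =>
  S.pairwise_disjoint_jointCell fun h' => h (congrArg Prod.fst h')

theorem iUnion_shellCell : ⋃ b, S.shellCell b = S.shell := by
  simp_rw [shellCell_eq]
  rw [← inter_iUnion, ← preimage_iUnion, S.partition.iUnion, inter_eq_left]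
  exact fun z hz => hz.1.1

theorem mem_shell_of_flow {t : ℝ} {z : Phase (ι ⊕ κ)} (hz : z ∈ S.Ω) (h : S.U t z ∈ S.shell) :
    z ∈ S.shell := by
  refine ⟨hz, ?_⟩
  rw [mem_preimage, ← S.isHamiltonianFlow.energy_eq S.isOpen_Ω S.contDiffOn_H t hz]
  exact h.2

theorem flow_mem_shell (t : ℝ) {z : Phase (ι ⊕ κ)} (h : z ∈ S.shell) : S.U t z ∈ S.shell := by
  refine ⟨S.flow.mapsTo t h.1, ?_⟩
  rw [mem_preimage, S.isHamiltonianFlow.energy_eq S.isOpen_Ω S.contDiffOn_H t h.1]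
  exact h.2

theorem measurableSet_inter_flow_preimage (t : ℝ) {A : Set (Phase (ι ⊕ κ))}
    (hA : MeasurableSet A) {Z : Set (Phase (ι ⊕ κ))} (hZ : MeasurableSet Z) (hZΩ : Z ⊆ S.Ω) :
    MeasurableSet (Z ∩ S.U t ⁻¹' A) := by
  have h := hZ.inter (measurableSet_inter_preimage_of_continuousOn S.isOpen_Ω.measurableSet
    (S.isHamiltonianFlow.continuousOn S.isOpen_Ω t) hA)
  rwa [← inter_assoc, inter_eq_left.2 hZΩ] at h

/-- The volume of the part of the energy shell on which the system is in the cell `b`. -/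
def cellVol (b : α) : ℝ := S.ω.real (S.shellCell b)

/-- The volume of the micro-states which are in the cell `b` at time `0` and in the cell `c` at
time `t`. -/
def transVol (t : ℝ) (b c : α) : ℝ := S.ω.real (S.shellCell c ∩ S.U (-t) ⁻¹' S.shellCell b)

theorem cellVol_nonneg (b : α) : 0 ≤ S.cellVol b := measureReal_nonneg

theorem transVol_nonneg (t : ℝ) (b c : α) : 0 ≤ S.transVol t b c := measureReal_nonneg

theorem measure_ne_top_of_subset_shell {D : Set (Phase (ι ⊕ κ))} (hD : D ⊆ S.shell) :
    S.ω D ≠ ⊤ := measure_ne_top_of_subset hD S.measure_shell_ne_top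

theorem transVol_le (t : ℝ) (b c : α) : S.transVol t b c ≤ S.cellVol c :=
  measureReal_mono inter_subset_left (S.measure_ne_top_of_subset_shell (S.shellCell_subset_shell c))

section Countable

variable [Countable α]

theorem hasSum_inter_shellCell {D : Set (Phase (ι ⊕ κ))} (hD : MeasurableSet D)
    (hDs : D ⊆ S.shell) : HasSum (fun b => S.ω.real (D ∩ S.shellCell b)) (S.ω.real D) := by
  have hU : ⋃ b, D ∩ S.shellCell b = D := by
    rw [← inter_iUnion, S.iUnion_shellCell, inter_eq_left.2 hDs]
  have h := hasSum_measureReal_iUnion (μ := S.ω) (s := fun b => D ∩ S.shellCell b)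
    (fun b c hbc => (S.pairwise_disjoint_shellCell hbc).mono inter_subset_right inter_subset_right)
    (fun b => hD.inter (S.measurableSet_shellCell b))
    (by rw [hU]; exact S.measure_ne_top_of_subset_shell hDs)
  rwa [hU] at h

theorem summable_cellVol : Summable S.cellVol := by
  refine (S.hasSum_inter_shellCell S.measurableSet_shell le_rfl).summable.congr fun b => ?_
  rw [cellVol, inter_eq_right.2 (S.shellCell_subset_shell b)]

/-- By Liouville's theorem the image of cell `b` still has volume `cellVol b`; it stays in the shell
and is divided among the cells `c`. -/
theorem hasSum_transVol_row (t : ℝ) (b : α) :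
    HasSum (fun c => S.transVol t b c) (S.cellVol b) := by
  have h := S.hasSum_inter_shellCell (D := S.Ω ∩ S.U (-t) ⁻¹' S.shellCell b)
    (S.measurableSet_inter_flow_preimage _ (S.measurableSet_shellCell b)
      S.isOpen_Ω.measurableSet le_rfl)
    fun z hz => S.mem_shell_of_flow hz.1 (S.shellCell_subset_shell b hz.2)
  have hvol : S.ω.real (S.Ω ∩ S.U (-t) ⁻¹' S.shellCell b) = S.cellVol b :=
    congrArg ENNReal.toReal (S.isHamiltonianFlow.liouville_inter_preimage S.isOpen_Ω S.contDiffOn_H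
      S.h t (S.shellCell_subset b) (S.measurableSet_shellCell b))
  rw [hvol] at h
  refine h.congr_fun fun c => ?_
  rw [transVol, inter_assoc, inter_comm (_ ⁻¹' _), ← inter_assoc,
    inter_eq_right.2 (S.shellCell_subset c)]

omit [Countable α] in
theorem iUnion_inter_flow_preimage (t : ℝ) (c : α) :
    ⋃ b, S.shellCell c ∩ S.U t ⁻¹' S.shellCell b = S.shellCell c := by
  rw [← inter_iUnion, ← preimage_iUnion, S.iUnion_shellCell, inter_eq_left]
  exact fun z hz => S.flow_mem_shell t (S.shellCell_subset_shell c hz)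

omit [Countable α] in
theorem pairwise_disjoint_inter_flow_preimage (t : ℝ) (c : α) :
    Pairwise (Function.onFun Disjoint fun b => S.shellCell c ∩ S.U t ⁻¹' S.shellCell b) :=
  fun _ _ hbc => ((S.pairwise_disjoint_shellCell hbc).preimage _).mono inter_subset_right
    inter_subset_right

/-- Each point of cell `c` comes from exactly one cell of the shell; this uses energy conservation
but not volume preservation. -/
theorem hasSum_transVol_col (t : ℝ) (c : α) :
    HasSum (fun b => S.transVol t b c) (S.cellVol c) := by
  have h := hasSum_measureReal_iUnion (μ := S.ω) (S.pairwise_disjoint_inter_flow_preimage (-t) c)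
    (fun b => S.measurableSet_inter_flow_preimage _ (S.measurableSet_shellCell b)
      (S.measurableSet_shellCell c) (S.shellCell_subset c))
    (by rw [iUnion_inter_flow_preimage]
        exact S.measure_ne_top_of_subset_shell (S.shellCell_subset_shell c))
  rwa [iUnion_inter_flow_preimage] at h

end Countable

/-! ### Cell densities of the evolved state, with and without intermediate coarse-graining. -/

theorem cellProb_fineState (t : ℝ) (a : α) {Z : Set (Phase (ι ⊕ κ))}
    (hZ : MeasurableSet Z) (hZΩ : Z ⊆ S.Ω) :
    cellProb S.ω (S.fineState a t) Z =
      S.ω.real (Z ∩ S.U (-t) ⁻¹' S.shellCell a) * (S.cellVol a)⁻¹ := by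
  have hm := S.measurableSet_inter_flow_preimage (-t) (S.measurableSet_shellCell a) hZ hZΩ
  rw [cellProb, setIntegral_congr_fun (g := (Z ∩ S.U (-t) ⁻¹' S.shellCell a).indicator
    fun _ => (S.cellVol a)⁻¹) hZ, setIntegral_indicator hm, setIntegral_const, smul_eq_mul,
    ← inter_assoc, inter_self]
  intro z hz
  change (S.shellCell a).indicator (fun _ => (S.cellVol a)⁻¹) (S.U (-t) z) = _
  by_cases h : S.U (-t) z ∈ S.shellCell a
  · rw [indicator_of_mem (show z ∈ Z ∩ S.U (-t) ⁻¹' S.shellCell a from ⟨hz, h⟩),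
      indicator_of_mem h]
  · rw [indicator_of_notMem (s := Z ∩ S.U (-t) ⁻¹' S.shellCell a) fun h' => h h'.2,
      indicator_of_notMem h]

/-- The system probability is taken over all total energies, but the evolved state is supported in
the initial shell. -/
theorem sysProb_eq (a : α) (t : ℝ) (b : α) :
    S.sysProb a t b = S.transVol t a b * (S.cellVol a)⁻¹ := by
  have hZ : MeasurableSet {z | z ∈ S.Ω ∧ sysPart z ∈ S.cell b} :=
    S.isOpen_Ω.measurableSet.inter
      ((contDiff_sysPart (n := 0)).continuous.measurable (S.partition.measurable b))
  rw [sysProb, S.cellProb_fineState t a hZ fun z hz => hz.1, transVol]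
  congr 2
  ext z
  rw [shellCell_eq S b]
  constructor
  · rintro ⟨⟨hz, hb⟩, ha⟩
    exact ⟨⟨S.mem_shell_of_flow hz (S.shellCell_subset_shell a ha), hb⟩, ha⟩
  · rintro ⟨⟨hz, hb⟩, ha⟩
    exact ⟨⟨hz.1, hb⟩, ha⟩

/-- The density of the distribution over the cells at time `t` with respect to their volumes. -/
def visitDensity (a : α) (t : ℝ) (b : α) : ℝ :=
  S.transVol t a b * (S.cellVol a)⁻¹ * (S.cellVol b)⁻¹

/-- The density over the cells at time `t + τ` if the distribution is coarse-grained at time `τ`. -/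
def regrainedDensity (a : α) (t τ : ℝ) (c : α) : ℝ :=
  (∑' b, S.transVol t b c * S.visitDensity a τ b) * (S.cellVol c)⁻¹

theorem coarseGrain_fineState (a : α) (t : ℝ) {b : α} {x : Phase (ι ⊕ κ)}
    (hx : x ∈ S.shellCell b) :
    coarseGrain S.ω S.jointCell (S.fineState a t) x = S.visitDensity a t b := by
  rw [coarseGrain_apply S.pairwise_disjoint_jointCell _ (a := (b, 0)) hx]
  change cellProb S.ω _ (S.shellCell b) * (S.cellVol b)⁻¹ = _
  rw [S.cellProb_fineState t a (S.measurableSet_shellCell b) (S.shellCell_subset b)]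
  rfl

theorem cellVol_mul_visitDensity (a : α) (t : ℝ) (b : α) :
    S.cellVol b * S.visitDensity a t b = S.sysProb a t b := by
  rw [sysProb_eq, visitDensity]
  -- On a null cell the density is `0` by the convention `0⁻¹ = 0`, and the probability vanishes as
  -- well.
  by_cases hb : S.cellVol b = 0
  · have : S.transVol t a b = 0 := le_antisymm (hb ▸ S.transVol_le t a b) (S.transVol_nonneg t a b)
    simp [hb, this]
  · field_simp

/-- The volume in cell `b` that came from `a` is at most that of `b`. The bound, uniform in time,
serves as `M` in the entropy estimates. -/
theorem visitDensity_mem (a : α) (t : ℝ) (b : α) :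
    S.visitDensity a t b ∈ Icc 0 (S.cellVol a)⁻¹ := by
  have ha := inv_nonneg.2 (S.cellVol_nonneg a)
  have hb := inv_nonneg.2 (S.cellVol_nonneg b)
  refine ⟨mul_nonneg (mul_nonneg (S.transVol_nonneg t a b) ha) hb, ?_⟩
  calc S.visitDensity a t b ≤ S.cellVol b * (S.cellVol a)⁻¹ * (S.cellVol b)⁻¹ := by
        unfold visitDensity; gcongr; exact S.transVol_le t a b
    _ = (S.cellVol a)⁻¹ * (S.cellVol b * (S.cellVol b)⁻¹) := by ring
    _ ≤ (S.cellVol a)⁻¹ := mul_le_of_le_one_right ha mul_inv_le_one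

variable [Countable α]

theorem summable_transVol_mul_visitDensity (a : α) (t τ : ℝ) (c : α) :
    Summable fun b => S.transVol t b c * S.visitDensity a τ b :=
  summable_mul_of_abs_le (fun b => S.transVol_nonneg t b c) (S.hasSum_transVol_col t c).summable
    (K := (S.cellVol a)⁻¹) fun b => by
      rw [abs_of_nonneg (S.visitDensity_mem a τ b).1]; exact (S.visitDensity_mem a τ b).2

theorem tsum_transVol_mul_visitDensity_le (a : α) (t τ : ℝ) (c : α) :
    ∑' b, S.transVol t b c * S.visitDensity a τ b ≤ S.cellVol c * (S.cellVol a)⁻¹ :=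
  hasSum_le (fun b => mul_le_mul_of_nonneg_left (S.visitDensity_mem a τ b).2
    (S.transVol_nonneg t b c)) (S.summable_transVol_mul_visitDensity a t τ c).hasSum
    ((S.hasSum_transVol_col t c).mul_right _)

omit [Countable α] in
theorem tsum_transVol_mul_visitDensity_nonneg (a : α) (t τ : ℝ) (c : α) :
    0 ≤ ∑' b, S.transVol t b c * S.visitDensity a τ b :=
  tsum_nonneg fun b => mul_nonneg (S.transVol_nonneg t b c) (S.visitDensity_mem a τ b).1

theorem cellVol_mul_regrainedDensity (a : α) (t τ : ℝ) (c : α) :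
    S.cellVol c * S.regrainedDensity a t τ c =
      ∑' b, S.transVol t b c * S.visitDensity a τ b := by
  rw [regrainedDensity]
  by_cases hc : S.cellVol c = 0
  · have h1 := S.tsum_transVol_mul_visitDensity_le a t τ c
    have h2 := S.tsum_transVol_mul_visitDensity_nonneg a t τ c
    rw [hc, zero_mul] at h1
    rw [le_antisymm h1 h2]
    simp
  · field_simp

theorem regrainedDensity_mem (a : α) (t τ : ℝ) (c : α) :
    S.regrainedDensity a t τ c ∈ Icc 0 (S.cellVol a)⁻¹ := by
  have ha := inv_nonneg.2 (S.cellVol_nonneg a)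
  have hc := inv_nonneg.2 (S.cellVol_nonneg c)
  refine ⟨mul_nonneg (S.tsum_transVol_mul_visitDensity_nonneg a t τ c) hc, ?_⟩
  calc S.regrainedDensity a t τ c ≤ S.cellVol c * (S.cellVol a)⁻¹ * (S.cellVol c)⁻¹ :=
        mul_le_mul_of_nonneg_right (S.tsum_transVol_mul_visitDensity_le a t τ c) hc
    _ = (S.cellVol a)⁻¹ * (S.cellVol c * (S.cellVol c)⁻¹) := by ring
    _ ≤ (S.cellVol a)⁻¹ := mul_le_of_le_one_right ha mul_inv_le_one

/-- The evolved coarse-grained function is constant on each piece of cell `c` that came from a given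
cell `b`, so its integral over `c` is a sum over `b`. -/
theorem coarseGrain_evolve_coarseGrain (a : α) (t τ : ℝ) {c : α} {x : Phase (ι ⊕ κ)}
    (hx : x ∈ S.shellCell c) :
    coarseGrain S.ω S.jointCell (evolve S.U t (coarseGrain S.ω S.jointCell (S.fineState a τ))) x =
      S.regrainedDensity a t τ c := by
  rw [coarseGrain_apply S.pairwise_disjoint_jointCell _ (a := (c, 0)) hx]
  change cellProb S.ω _ (S.shellCell c) * (S.cellVol c)⁻¹ = _
  rw [regrainedDensity]
  congr 1
  set R := evolve S.U t (coarseGrain S.ω S.jointCell (S.fineState a τ)) with hR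
  have hm : ∀ b, MeasurableSet (S.shellCell c ∩ S.U (-t) ⁻¹' S.shellCell b) := fun b =>
    S.measurableSet_inter_flow_preimage _ (S.measurableSet_shellCell b)
      (S.measurableSet_shellCell c) (S.shellCell_subset c)
  have hval : ∀ b, EqOn R (fun _ => S.visitDensity a τ b)
      (S.shellCell c ∩ S.U (-t) ⁻¹' S.shellCell b) := fun b z hz =>
    S.coarseGrain_fineState a τ hz.2
  have hfin : ∀ b, S.ω (S.shellCell c ∩ S.U (-t) ⁻¹' S.shellCell b) ≠ ⊤ := fun b =>
    S.measure_ne_top_of_subset_shell (inter_subset_left.trans (S.shellCell_subset_shell c))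
  have hint : IntegrableOn R (⋃ b, S.shellCell c ∩ S.U (-t) ⁻¹' S.shellCell b) S.ω := by
    refine integrableOn_iUnion_of_summable_integral_norm (fun b => ?_) ?_
    · exact (integrableOn_const (hfin b)).congr_fun (hval b).symm (hm b)
    · refine (S.summable_transVol_mul_visitDensity a t τ c).congr fun b => ?_
      rw [setIntegral_congr_fun (hm b) fun z hz => congrArg norm (hval b hz), setIntegral_const,
        smul_eq_mul, Real.norm_of_nonneg (S.visitDensity_mem a τ b).1]
      rfl
  have h := hasSum_integral_iUnion hm (S.pairwise_disjoint_inter_flow_preimage (-t) c) hint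
  rw [iUnion_inter_flow_preimage] at h
  rw [cellProb, ← h.tsum_eq]
  refine tsum_congr fun b => ?_
  rw [setIntegral_congr_fun (hm b) (hval b), setIntegral_const, smul_eq_mul]
  rfl

/-! ### Local mixing and monotonicity of the coarse-grained entropy. -/

omit [Countable α] in
theorem exists_mem_shellCell {c : α} (hc : S.cellVol c ≠ 0) : ∃ x, x ∈ S.shellCell c := by
  by_contra h
  push Not at h
  exact hc (by rw [cellVol, eq_empty_of_forall_notMem h, measureReal_empty])

/-- Mixing is an identity of functions on phase space and is read off at a point of the cell. Null
cells, possibly empty, have no weight in the entropy. -/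
theorem regrainedDensity_eq_of_isLocalMixingTime {τ₀ : ℝ}
    (hmix : IsLocalMixingTime S.ω S.jointCell S.U τ₀) (a : α) {t τ : ℝ} (ht : τ₀ ≤ t)
    (hτ : τ₀ ≤ τ) {c : α} (hc : S.cellVol c ≠ 0) :
    S.visitDensity a (t + τ) c = S.regrainedDensity a t τ c := by
  obtain ⟨x, hx⟩ := S.exists_mem_shellCell hc
  rw [← S.coarseGrain_fineState a (t + τ) hx, ← S.coarseGrain_evolve_coarseGrain a t τ hx]
  exact congrFun (hmix.2 (a, 0) t τ ht hτ) x

theorem tendsto_visitDensity_sub_regrainedDensity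
    (hmix : IsLocallyMixing S.ω S.jointCell S.U) (a : α) {c : α} (hc : S.cellVol c ≠ 0) :
    Tendsto (fun s : ℝ × ℝ => S.visitDensity a (s.1 + s.2) c - S.regrainedDensity a s.1 s.2 c)
      (atTop ×ˢ atTop) (𝓝 0) := by
  obtain ⟨x, hx⟩ := S.exists_mem_shellCell hc
  refine (hmix (a, 0) x).congr fun s => ?_
  rw [← S.coarseGrain_fineState a (s.1 + s.2) hx, ← S.coarseGrain_evolve_coarseGrain a s.1 s.2 hx]
  rfl

omit [Countable α] in
theorem transVol_zero_self (a : α) : S.transVol 0 a a = S.cellVol a := by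
  rw [transVol, cellVol]
  congr 1
  refine inter_eq_left.2 fun z hz => ?_
  rw [mem_preimage, neg_zero, S.flow.zero z (S.shellCell_subset a hz)]
  exact hz

omit [Countable α] in
theorem transVol_zero_of_ne {a b : α} (h : b ≠ a) : S.transVol 0 a b = 0 := by
  rw [transVol]
  convert measureReal_empty (μ := S.ω)
  refine eq_empty_of_forall_notMem fun z hz => ?_
  have hz2 := hz.2
  rw [mem_preimage, neg_zero, S.flow.zero z (S.shellCell_subset b hz.1)] at hz2
  exact (S.pairwise_disjoint_shellCell h).le_bot ⟨hz.1, hz2⟩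

-- Coarse-graining at time `0` loses nothing, since the initial state is already uniform on cell
-- `a`.
omit [Countable α] in
theorem cellVol_mul_visitDensity_eq_tsum {a : α} (ha : S.cellVol a ≠ 0) (t : ℝ) (c : α) :
    S.cellVol c * S.visitDensity a t c = ∑' b, S.transVol t b c * S.visitDensity a 0 b := by
  rw [cellVol_mul_visitDensity, sysProb_eq, tsum_eq_single a fun b hb => ?_]
  · rw [visitDensity, transVol_zero_self, mul_inv_cancel₀ ha, one_mul]
  · rw [visitDensity, S.transVol_zero_of_ne hb, zero_mul, zero_mul, mul_zero]

/-- The coarse-grained negative entropy of system plus bath at time `t`. -/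
def jointNegEntropy (a : α) (t : ℝ) : ℝ := negEntropy S.cellVol (S.visitDensity a t)

theorem jointNegEntropy_le_zero {a : α} (ha : S.cellVol a ≠ 0) (t : ℝ) :
    S.jointNegEntropy a t ≤ S.jointNegEntropy a 0 :=
  negEntropy_le_of_kernel S.cellVol_nonneg S.summable_cellVol (S.transVol_nonneg t)
    (S.hasSum_transVol_row t) (S.hasSum_transVol_col t) (S.visitDensity_mem a 0)
    (S.visitDensity_mem a t) (S.cellVol_mul_visitDensity_eq_tsum ha t)

theorem negEntropy_regrainedDensity_le (a : α) (t τ : ℝ) :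
    negEntropy S.cellVol (S.regrainedDensity a t τ) ≤ S.jointNegEntropy a τ :=
  negEntropy_le_of_kernel S.cellVol_nonneg S.summable_cellVol (S.transVol_nonneg t)
    (S.hasSum_transVol_row t) (S.hasSum_transVol_col t) (S.visitDensity_mem a τ)
    (S.regrainedDensity_mem a t τ) (S.cellVol_mul_regrainedDensity a t τ)

theorem jointNegEntropy_add_le {τ₀ : ℝ} (hmix : IsLocalMixingTime S.ω S.jointCell S.U τ₀) (a : α)
    {t τ : ℝ} (ht : τ₀ ≤ t) (hτ : τ₀ ≤ τ) :
    S.jointNegEntropy a (t + τ) ≤ S.jointNegEntropy a τ := by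
  refine le_trans (le_of_eq ?_) (S.negEntropy_regrainedDensity_le a t τ)
  refine tsum_congr fun c => ?_
  by_cases hc : S.cellVol c = 0
  · simp [hc]
  · rw [S.regrainedDensity_eq_of_isLocalMixingTime hmix a ht hτ hc]

theorem exists_jointNegEntropy_add_le (hmix : IsLocallyMixing S.ω S.jointCell S.U) (a : α) {ε : ℝ}
    (hε : 0 < ε) : ∃ τ₀ : ℝ, 0 ≤ τ₀ ∧ ∀ t τ, τ₀ ≤ t → τ₀ ≤ τ →
      S.jointNegEntropy a (t + τ) ≤ S.jointNegEntropy a τ + ε := by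
  have hlim := tendsto_negEntropy_sub S.cellVol_nonneg S.summable_cellVol
    (f := fun s : ℝ × ℝ => S.visitDensity a (s.1 + s.2))
    (g := fun s => S.regrainedDensity a s.1 s.2) (l := atTop ×ˢ atTop) (M := (S.cellVol a)⁻¹)
    (Eventually.of_forall fun s => S.visitDensity_mem a _)
    (Eventually.of_forall fun s => S.regrainedDensity_mem a _ _)
    fun c hc => S.tendsto_visitDensity_sub_regrainedDensity hmix a hc
  have hev := hlim.eventually (gt_mem_nhds hε)
  rw [prod_atTop_atTop_eq, eventually_atTop] at hev
  obtain ⟨s₀, hs₀⟩ := hev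
  refine ⟨max 0 (max s₀.1 s₀.2), le_max_left _ _, fun t τ ht hτ => ?_⟩
  have h := hs₀ (t, τ) ⟨((le_max_left _ _).trans (le_max_right _ _)).trans ht,
    ((le_max_right _ _).trans (le_max_right _ _)).trans hτ⟩
  have h2 := S.negEntropy_regrainedDensity_le a t τ
  rw [jointNegEntropy]
  simp only at h
  linarith

end SystemWithBath

/-! ## The Liouville measure of system plus bath is a product measure -/

section Product

/-- Regroups positions and momenta, `((q_S, q_B), (p_S, p_B))`, into system and bath, `((q_S, p_S),
(q_B, p_B))`. -/
theorem measurePreserving_prod_prod_comm {A B C D : Type*} [MeasurableSpace A] [MeasurableSpace B]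
    [MeasurableSpace C] [MeasurableSpace D] (μa : Measure A) (μb : Measure B) (μc : Measure C)
    (μd : Measure D) [SFinite μa] [SFinite μb] [SFinite μc] [SFinite μd] :
    MeasurePreserving (fun z : (A × B) × C × D => ((z.1.1, z.2.1), z.1.2, z.2.2))
      ((μa.prod μb).prod (μc.prod μd)) ((μa.prod μc).prod (μb.prod μd)) := by
  have hg : MeasurePreserving (fun z : B × C × D => (z.2.1, z.1, z.2.2))
      (μb.prod (μc.prod μd)) (μc.prod (μb.prod μd)) :=
    (measurePreserving_prodAssoc μc μb μd).comp
      (((Measure.measurePreserving_swap (μ := μb) (ν := μc)).prod (MeasurePreserving.id μd)).comp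
        ((measurePreserving_prodAssoc μb μc μd).symm MeasurableEquiv.prodAssoc))
  exact ((measurePreserving_prodAssoc μa μc (μb.prod μd)).symm MeasurableEquiv.prodAssoc).comp
    (((MeasurePreserving.id μa).prod hg).comp
      (measurePreserving_prodAssoc μa μb (μc.prod μd)))

variable {ι κ : Type*} [Fintype ι] [Fintype κ]

theorem measurePreserving_parts :
    MeasurePreserving (fun z : Phase (ι ⊕ κ) => (sysPart z, bathPart z)) volume
      ((volume : Measure (Phase ι)).prod (volume : Measure (Phase κ))) := by
  have h := volume_measurePreserving_sumPiEquivProdPi (fun _ : ι ⊕ κ => ℝ)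
  exact (measurePreserving_prod_prod_comm (volume : Measure (ι → ℝ)) (volume : Measure (κ → ℝ))
    (volume : Measure (ι → ℝ)) (volume : Measure (κ → ℝ))).comp (h.prod h)

theorem liouville_parts_preimage {h : ℝ} (hh : 0 < h) {A : Set (Phase ι)} {B : Set (Phase κ)}
    (hA : MeasurableSet A) (hB : MeasurableSet B) :
    liouville (ι ⊕ κ) h (sysPart ⁻¹' A ∩ bathPart ⁻¹' B) = liouville ι h A * liouville κ h B := by
  have hvol := (measurePreserving_parts (ι := ι) (κ := κ)).measure_preimage
    (hA.prod hB).nullMeasurableSet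
  rw [Measure.prod_prod] at hvol
  have hset : (fun z : Phase (ι ⊕ κ) => (sysPart z, bathPart z)) ⁻¹' (A ×ˢ B) =
      sysPart ⁻¹' A ∩ bathPart ⁻¹' B := rfl
  simp only [liouville, Measure.smul_apply, smul_eq_mul]
  rw [← hset, hvol, Fintype.card_sum, pow_add, ENNReal.ofReal_mul (by positivity),
    ENNReal.mul_inv (Or.inr ENNReal.ofReal_ne_top)
      (Or.inl ENNReal.ofReal_ne_top)]
  ring

end Product

/-! ## Volumes of the energy shells of an ideal heat bath -/

section Estimates

theorem integral_exp_div {T : ℝ} (hT : T ≠ 0) (e e' : ℝ) :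
    ∫ s in e..e', Real.exp (s / T) = T * (Real.exp (e' / T) - Real.exp (e / T)) := by
  rw [intervalIntegral.integral_comp_div (fun x => Real.exp x) hT, integral_exp, smul_eq_mul]

theorem exp_neg_two_mul_le {x : ℝ} (h0 : 0 ≤ x) (h1 : x ≤ 1 / 2) :
    Real.exp (-(2 * x)) ≤ 1 - x := by
  rw [Real.exp_neg]
  have h2 : 2 * x + 1 ≤ Real.exp (2 * x) := Real.add_one_le_exp _
  rw [inv_le_comm₀ (Real.exp_pos _) (by linarith), inv_le_iff_one_le_mul₀ (by linarith)]
  nlinarith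

/-- With `u = Δ / T`, this compares the weights at the two ends of a shell with its volume,
uniformly in `u`. It is why accuracy is measured against `min Δ T`. -/
theorem min_one_mul_exp_add_one_le {u : ℝ} (hu : 0 ≤ u) :
    min u 1 * (Real.exp u + 1) ≤ 4 * (Real.exp u - 1) := by
  have h := Real.add_one_le_exp u
  rcases le_total u 1 with h1 | h1
  · rw [min_eq_left h1]
    have h3 : Real.exp u ≤ 3 :=
      (Real.exp_le_exp.2 h1).trans (Real.exp_one_lt_d9.le.trans (by norm_num))
    nlinarith
  · rw [min_eq_right h1]
    linarith

/-- Displacements of the ends of an energy shell which are small compared with the width of the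
shell and with the temperature change the volume of the shell by a small factor. -/
theorem exp_sub_exp_bounds {u c η : ℝ} (hu : 0 ≤ u) (hη : 0 ≤ η) (hη' : η ≤ 1 / 32)
    (hc : 0 ≤ c) (hcu : c ≤ 2 * η * min u 1) :
    Real.exp (u + c) - Real.exp (-c) ≤ Real.exp (32 * η) * (Real.exp u - 1) ∧
      Real.exp (-(32 * η)) * (Real.exp u - 1) ≤ Real.exp (u - c) - Real.exp c := by
  have hc1 : c ≤ 2 * η := hcu.trans (mul_le_of_le_one_right (by linarith) (min_le_right _ _))
  have hexp : Real.exp c - 1 ≤ 2 * c := by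
    have h := Real.add_one_le_exp (-c)
    have h2 : Real.exp c * Real.exp (-c) = 1 := by rw [← Real.exp_add, add_neg_cancel, Real.exp_zero]
    have h3 : Real.exp c * (1 - c) ≤ 1 := by
      rw [← h2]; exact mul_le_mul_of_nonneg_left (by linarith) (Real.exp_pos c).le
    have h4 : c ≤ 1 / 16 := by linarith
    nlinarith
  have hneg : 1 - Real.exp (-c) ≤ Real.exp c - 1 := by
    have := Real.add_one_le_exp c
    have := Real.add_one_le_exp (-c)
    linarith
  have h1u : 1 ≤ Real.exp u := Real.one_le_exp hu
  -- The left side bounds the change of volume when both ends move by `c`, outwards or inwards. The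
  -- relative error `16 η` fits into `exp (± 32 η)`; the lower bound needs `16 η ≤ 1 / 2`, that is
  -- `η ≤ 1 / 32`.
  have hmain : (Real.exp u + 1) * (Real.exp c - 1) ≤ 16 * η * (Real.exp u - 1) := by
    calc (Real.exp u + 1) * (Real.exp c - 1) ≤ (Real.exp u + 1) * (2 * (2 * η * min u 1)) := by
          gcongr; linarith
      _ = 4 * η * (min u 1 * (Real.exp u + 1)) := by ring
      _ ≤ 4 * η * (4 * (Real.exp u - 1)) :=
          mul_le_mul_of_nonneg_left (min_one_mul_exp_add_one_le hu) (by linarith)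
      _ = _ := by ring
  constructor
  · have hb : 1 + 16 * η ≤ Real.exp (32 * η) := by linarith [Real.add_one_le_exp (32 * η)]
    have := mul_le_mul_of_nonneg_right hb (sub_nonneg.2 h1u)
    rw [Real.exp_add]
    nlinarith
  · have hb := exp_neg_two_mul_le (x := 16 * η) (by linarith) (by linarith)
    have h3 : 2 * (16 * η) = 32 * η := by ring
    rw [h3] at hb
    have := mul_le_mul_of_nonneg_right hb (sub_nonneg.2 h1u)
    rw [sub_eq_add_neg u, Real.exp_add]
    have := mul_le_mul_of_nonneg_left hneg (Real.exp_pos u).le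
    nlinarith

theorem integral_exp_shell_bounds {T Δ η c : ℝ} (hT : 0 < T) (hΔ : 0 < Δ) (hη : 0 ≤ η)
    (hη' : η ≤ 1 / 32) (hc : 0 ≤ c) (hcm : c ≤ 2 * (η * min Δ T)) (e : ℝ) :
    (∫ s in (e - c)..(e + Δ + c), Real.exp (s / T)) ≤
        Real.exp (32 * η) * (T * Real.exp (e / T) * (Real.exp (Δ / T) - 1)) ∧
      Real.exp (-(32 * η)) * (T * Real.exp (e / T) * (Real.exp (Δ / T) - 1)) ≤
        ∫ s in (e + c)..(e + Δ - c), Real.exp (s / T) := by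
  have hcu : c / T ≤ 2 * η * min (Δ / T) 1 := by
    rw [← div_self hT.ne', min_div_div_right hT.le, mul_div_assoc', mul_assoc]
    gcongr
  obtain ⟨h1, h2⟩ := exp_sub_exp_bounds (div_pos hΔ hT).le hη hη' (div_nonneg hc hT.le) hcu
  have hpos : 0 ≤ T * Real.exp (e / T) := by positivity
  rw [integral_exp_div hT.ne', integral_exp_div hT.ne']
  have h1' := mul_le_mul_of_nonneg_left h1 hpos
  have h2' := mul_le_mul_of_nonneg_left h2 hpos
  constructor
  · calc T * (Real.exp ((e + Δ + c) / T) - Real.exp ((e - c) / T))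
        = T * Real.exp (e / T) * (Real.exp (Δ / T + c / T) - Real.exp (-(c / T))) := by
          rw [mul_assoc, mul_sub (Real.exp (e / T)), ← Real.exp_add, ← Real.exp_add]
          ring_nf
      _ ≤ _ := h1'
      _ = _ := by ring
  · calc _ = T * Real.exp (e / T) * (Real.exp (-(32 * η)) * (Real.exp (Δ / T) - 1)) := by ring
      _ ≤ _ := h2'
      _ = T * (Real.exp ((e + Δ - c) / T) - Real.exp ((e + c) / T)) := by
          rw [mul_assoc, mul_sub (Real.exp (e / T)), ← Real.exp_add, ← Real.exp_add]
          ring_nf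

end Estimates

namespace SystemWithBath

variable {ι κ α : Type*} [Fintype ι] [Fintype κ] [DecidableEq ι] [DecidableEq κ]
variable (S : SystemWithBath ι κ α)

/-- The volume of a Boltzmann cell of the system. -/
def sysVol (b : α) : ℝ := (liouville ι S.h).real (S.cell b)

theorem sysVol_nonneg (b : α) : 0 ≤ S.sysVol b := measureReal_nonneg

theorem cell_subset (b : α) : S.cell b ⊆ S.ΩS := by
  rw [← S.partition.iUnion]; exact subset_iUnion S.cell b

theorem sysVol_pos_of_cellVol_ne_zero {b : α} (hb : S.cellVol b ≠ 0) : 0 < S.sysVol b := by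
  refine (S.sysVol_nonneg b).lt_of_ne fun h => hb ?_
  have h0 : liouville ι S.h (S.cell b) = 0 :=
    (measureReal_eq_zero_iff (S.partition.finite b)).1 h.symm
  have h1 := liouville_parts_preimage (κ := κ) S.h_pos (S.partition.measurable b) MeasurableSet.univ
  rw [h0, zero_mul] at h1
  have h2 : S.ω (S.shellCell b) = 0 := by
    refine measure_mono_null ?_ h1
    rw [shellCell_eq, preimage_univ, inter_univ]
    exact inter_subset_right
  rw [cellVol, measureReal_def, h2, ENNReal.toReal_zero]

theorem integrableOn_HS {m : ℝ} {b : α}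
    (hres : ∀ x ∈ S.cell b, ∀ y ∈ S.cell b, |S.HS x - S.HS y| ≤ m) :
    IntegrableOn S.HS (S.cell b) (liouville ι S.h) := by
  rcases (S.cell b).eq_empty_or_nonempty with he | ⟨y, hy⟩
  · rw [he]; exact integrableOn_empty
  refine IntegrableOn.of_bound (S.partition.finite b).lt_top ?_ (|S.HS y| + m) ?_
  · exact (S.contDiffOn_HS.continuousOn.mono (S.cell_subset b)).aestronglyMeasurable
      (S.partition.measurable b)
  · refine (ae_restrict_iff' (S.partition.measurable b)).2 (Eventually.of_forall fun x hx => ?_)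
    have := hres x hx y hy
    have h2 := abs_add_le (S.HS y) (S.HS x - S.HS y)
    rw [add_sub_cancel] at h2
    rw [Real.norm_eq_abs]
    linarith

theorem sysVol_mul_cellEnergy (b : α) (hb : S.sysVol b ≠ 0) :
    S.sysVol b * S.cellEnergy b = ∫ x in S.cell b, S.HS x ∂(liouville ι S.h) := by
  have h : ∀ x, boltzmannState (liouville ι S.h) (S.cell b) x * S.HS x =
      (S.cell b).indicator (fun x => (S.sysVol b)⁻¹ * S.HS x) x := by
    intro x
    by_cases hx : x ∈ S.cell b
    · rw [boltzmannState, indicator_of_mem hx, indicator_of_mem hx]; rfl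
    · rw [boltzmannState, indicator_of_notMem hx, indicator_of_notMem hx, zero_mul]
  rw [cellEnergy]
  simp_rw [h]
  rw [setIntegral_indicator (S.partition.measurable b), inter_eq_right.2 (S.cell_subset b),
    integral_const_mul, ← mul_assoc, mul_inv_cancel₀ hb, one_mul]

/-- Average the bound on `H_S x - H_S y` over `y` in the cell. -/
theorem abs_HS_sub_cellEnergy_le {m : ℝ} {b : α}
    (hres : ∀ x ∈ S.cell b, ∀ y ∈ S.cell b, |S.HS x - S.HS y| ≤ m) (hb : 0 < S.sysVol b)
    {x : Phase ι} (hx : x ∈ S.cell b) : |S.HS x - S.cellEnergy b| ≤ m := by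
  have h1 : ∫ y in S.cell b, (S.HS x - S.HS y) ∂(liouville ι S.h) =
      S.sysVol b * (S.HS x - S.cellEnergy b) := by
    rw [integral_sub (integrableOn_const (C := S.HS x) (S.partition.finite b)) (S.integrableOn_HS hres),
      ← S.sysVol_mul_cellEnergy b hb.ne', setIntegral_const, smul_eq_mul, mul_sub]
    rfl
  have h2 := norm_setIntegral_le_of_norm_le_const (μ := liouville ι S.h)
    (f := fun y => S.HS x - S.HS y) (S.partition.finite b).lt_top (fun y hy => hres x hx y hy)
  rw [h1, Real.norm_eq_abs, abs_mul, abs_of_pos hb, mul_comm] at h2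
  exact le_of_mul_le_mul_right h2 hb

/-- The micro-states of the bath with energy in `[e, e')`. -/
def bathShell (e e' : ℝ) : Set (Phase κ) := {y | y ∈ S.ΩB ∧ e ≤ S.HB y ∧ S.HB y < e'}

theorem measurableSet_bathShell (e e' : ℝ) : MeasurableSet (S.bathShell e e') :=
  measurableSet_inter_preimage_of_continuousOn S.isOpen_ΩB.measurableSet
    S.contDiffOn_HB.continuousOn measurableSet_Ico

theorem real_parts_preimage (b : α) (e e' : ℝ) :
    S.ω.real (sysPart ⁻¹' S.cell b ∩ bathPart ⁻¹' S.bathShell e e') =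
      S.sysVol b * (liouville κ S.h).real (S.bathShell e e') := by
  rw [measureReal_def, ω, liouville_parts_preimage S.h_pos (S.partition.measurable b)
    (S.measurableSet_bathShell e e'), ENNReal.toReal_mul]
  rfl

/-- If the interaction is weak and the energy of the system is resolved, the cells of system plus
bath are products up to a small displacement of the ends of the energy shells of the bath. -/
theorem cellVol_bounds {m : ℝ} {b : α}
    (hres : ∀ x ∈ S.cell b, ∀ y ∈ S.cell b, |S.HS x - S.HS y| ≤ m) (hV : ∀ z ∈ S.Ω, |S.V z| ≤ m)
    (hb : 0 < S.sysVol b) :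
    S.sysVol b * (liouville κ S.h).real (S.bathShell (S.E - S.cellEnergy b + 2 * m)
        (S.E - S.cellEnergy b + S.Δ - 2 * m)) ≤ S.cellVol b ∧
      (0 < (liouville κ S.h).real (S.bathShell (S.E - S.cellEnergy b - 2 * m)
          (S.E - S.cellEnergy b + S.Δ + 2 * m)) →
        S.cellVol b ≤ S.sysVol b * (liouville κ S.h).real
          (S.bathShell (S.E - S.cellEnergy b - 2 * m)
            (S.E - S.cellEnergy b + S.Δ + 2 * m))) := by
  rw [← real_parts_preimage, ← real_parts_preimage]
  constructor
  · refine measureReal_mono ?_ (S.measure_ne_top_of_subset_shell (S.shellCell_subset_shell b))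
    rintro z ⟨hz, hy, h1, h2⟩
    have hzΩ : z ∈ S.Ω := ⟨S.cell_subset b hz, hy⟩
    -- The spread of `H_S` and the interaction each cost `m`, whence the displacement `2 * m`.
    have h3 := abs_le.1 (S.abs_HS_sub_cellEnergy_le hres hb hz)
    have h4 := abs_le.1 (hV z hzΩ)
    rw [shellCell_eq]
    refine ⟨⟨hzΩ, ?_⟩, hz⟩
    simp only [mem_preimage, H, jointHamiltonian, mem_Ico]
    constructor <;> linarith
  -- Positivity rules out a bath shell of infinite volume, to which `Measure.real` assigns `0`.
  · intro hpos
    refine measureReal_mono ?_ ?_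
    · intro z hz
      rw [shellCell_eq] at hz
      obtain ⟨⟨hzΩ, h1⟩, hz⟩ := hz
      have h3 := abs_le.1 (S.abs_HS_sub_cellEnergy_le hres hb hz)
      have h4 := abs_le.1 (hV z hzΩ)
      simp only [mem_preimage, H, jointHamiltonian, mem_Ico] at h1
      refine ⟨hz, hzΩ.2, ?_, ?_⟩ <;> linarith
    · change liouville (ι ⊕ κ) S.h _ ≠ ⊤
      rw [liouville_parts_preimage S.h_pos (S.partition.measurable b)
        (S.measurableSet_bathShell _ _)]
      refine ENNReal.mul_ne_top (S.partition.finite b) fun htop => ?_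
      rw [measureReal_def, htop, ENNReal.toReal_top] at hpos
      exact hpos.false

theorem cellVol_ne_zero_of_sysProb_ne_zero {a b : α} {t : ℝ} (h : S.sysProb a t b ≠ 0) :
    S.cellVol b ≠ 0 := by
  rw [← cellVol_mul_visitDensity] at h
  exact left_ne_zero_of_mul h

/-- For a thermostated system the logarithm of the volume of the cells of system plus bath is
`log |B| - E(B) / T`, up to a constant and a small error. -/
theorem IsThermostated.exists_abs_log_cellVol_le {S : SystemWithBath ι κ α} {T η : ℝ} {a : α}
    (hS : S.IsThermostated T η a) (hT : 0 < T) (hη : 0 ≤ η) (hη' : η ≤ 1 / 32) :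
    ∃ K : ℝ, ∀ b, (∃ t, 0 ≤ t ∧ S.sysProb a t b ≠ 0) →
      |Real.log (S.cellVol b / S.sysVol b) + S.cellEnergy b / T - K| ≤ 33 * η := by
  obtain ⟨g, hg, hbath⟩ := hS.heat_bath
  have hu : 0 < Real.exp (S.Δ / T) - 1 := by
    have := Real.add_one_le_exp (S.Δ / T)
    have := div_pos S.Δ_pos hT
    linarith
  -- The ideal bath volume is `g ∫ exp (s / T)` over `[e, e + Δ]` with `e = E - E(b)`; `K` is its
  -- logarithm without the term `-E(b) / T`. Of the error `33 η`, `32 η` comes from the displaced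
  -- ends and `η` from the bath.
  refine ⟨Real.log (g * (T * (Real.exp (S.Δ / T) - 1))) + S.E / T, fun b hvisit => ?_⟩
  obtain ⟨t, -, ht⟩ := id hvisit
  have hcell := (S.cellVol_nonneg b).lt_of_ne (S.cellVol_ne_zero_of_sysProb_ne_zero ht).symm
  have hsys := S.sysVol_pos_of_cellVol_ne_zero hcell.ne'
  set m := η * min S.Δ T with hm
  have hm0 : 0 ≤ m := mul_nonneg hη (le_min S.Δ_pos.le hT.le)
  -- Keeps the displaced shells nondegenerate and inside the window where the bath law is assumed.
  have hmΔ : 32 * m ≤ S.Δ := by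
    have h1 : m ≤ η * S.Δ := mul_le_mul_of_nonneg_left (min_le_left _ _) hη
    have h2 : η * S.Δ ≤ 1 / 32 * S.Δ := mul_le_mul_of_nonneg_right hη' S.Δ_pos.le
    linarith
  have hΔ := S.Δ_pos
  obtain ⟨hlow, hup⟩ := S.cellVol_bounds (hS.energy_resolved b) hS.weak_interaction hsys
  set e := S.E - S.cellEnergy b with he
  obtain ⟨hI1, hI2⟩ := integral_exp_shell_bounds hT S.Δ_pos hη hη'
    (mul_nonneg zero_le_two hm0) le_rfl e
  have hb1 := hbath b hvisit (e - 2 * m) (e + S.Δ + 2 * m) (by linarith) (by linarith) (by linarith)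
  have hb2 := hbath b hvisit (e + 2 * m) (e + S.Δ - 2 * m) (by linarith) (by linarith) (by linarith)
  set J := T * Real.exp (e / T) * (Real.exp (S.Δ / T) - 1) with hJ
  have hJpos : 0 < J := by positivity
  have hIpos : 0 < ∫ s in (e - 2 * m)..(e + S.Δ + 2 * m), Real.exp (s / T) :=
    intervalIntegral.intervalIntegral_pos_of_pos (Continuous.intervalIntegrable (by fun_prop) _ _)
      (fun _ => Real.exp_pos _) (by linarith)
  have hupper : S.cellVol b ≤ S.sysVol b * (Real.exp (33 * η) * (g * J)) := by
    refine (hup (lt_of_lt_of_le (by positivity) hb1.1)).trans ?_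
    refine mul_le_mul_of_nonneg_left (hb1.2.trans ?_) hsys.le
    calc Real.exp η * (g * ∫ s in (e - 2 * m)..(e + S.Δ + 2 * m), Real.exp (s / T))
        ≤ Real.exp η * (g * (Real.exp (32 * η) * J)) := by gcongr
      _ = (Real.exp η * Real.exp (32 * η)) * (g * J) := by ring
      _ = Real.exp (33 * η) * (g * J) := by rw [← Real.exp_add]; ring_nf
  have hlower : S.sysVol b * (Real.exp (-(33 * η)) * (g * J)) ≤ S.cellVol b := by
    refine le_trans (mul_le_mul_of_nonneg_left (le_trans ?_ hb2.1) hsys.le) hlow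
    calc Real.exp (-(33 * η)) * (g * J)
        = (Real.exp (-η) * Real.exp (-(32 * η))) * (g * J) := by rw [← Real.exp_add]; ring_nf
      _ = Real.exp (-η) * (g * (Real.exp (-(32 * η)) * J)) := by ring
      _ ≤ Real.exp (-η) * (g * ∫ s in (e + 2 * m)..(e + S.Δ - 2 * m), Real.exp (s / T)) := by
          gcongr
  have hratio : 0 < S.cellVol b / S.sysVol b := div_pos hcell hsys
  have hgJ : Real.log (g * J) =
      Real.log (g * (T * (Real.exp (S.Δ / T) - 1))) + S.E / T - S.cellEnergy b / T := by
    have : g * J = g * (T * (Real.exp (S.Δ / T) - 1)) * Real.exp (e / T) := by rw [hJ]; ring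
    rw [this, Real.log_mul (by positivity) (Real.exp_pos _).ne', Real.log_exp, he]
    ring
  have h1 : Real.log (S.cellVol b / S.sysVol b) ≤ 33 * η + Real.log (g * J) := by
    rw [← Real.log_exp (33 * η), ← Real.log_mul (Real.exp_pos _).ne' (by positivity)]
    exact Real.log_le_log hratio ((div_le_iff₀' hsys).2 hupper)
  have h2 : -(33 * η) + Real.log (g * J) ≤ Real.log (S.cellVol b / S.sysVol b) := by
    rw [← Real.log_exp (-(33 * η)), ← Real.log_mul (Real.exp_pos _).ne' (by positivity)]
    exact Real.log_le_log (by positivity) ((le_div_iff₀' hsys).2 hlower)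
  rw [abs_le]
  constructor <;> linarith

end SystemWithBath

/-! ## The free energy of the coarse-grained macro-state -/

namespace SystemWithBath

variable {ι κ α : Type*} [Fintype ι] [Fintype κ] [DecidableEq ι] [DecidableEq κ]
variable (S : SystemWithBath ι κ α)

theorem sysProb_nonneg (a : α) (t : ℝ) (b : α) : 0 ≤ S.sysProb a t b := by
  rw [← cellVol_mul_visitDensity]
  exact mul_nonneg (S.cellVol_nonneg b) (S.visitDensity_mem a t b).1

theorem hasSum_sysProb [Countable α] {a : α} (ha : S.cellVol a ≠ 0) (t : ℝ) :
    HasSum (S.sysProb a t) 1 := by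
  have h := (S.hasSum_transVol_row t a).mul_right (S.cellVol a)⁻¹
  rw [mul_inv_cancel₀ ha] at h
  exact h.congr_fun fun b => S.sysProb_eq a t b

/-- The contribution of the cell `b` to the free energy. -/
def cellFreeEnergy (T : ℝ) (a : α) (t : ℝ) (b : α) : ℝ :=
  S.sysProb a t b * (S.cellEnergy b + T * Real.log (S.sysProb a t b * (S.sysVol b)⁻¹))

theorem freeEnergyDensity_macroState (T : ℝ) (a : α) (t : ℝ) {b : α} {x : Phase ι}
    (hx : x ∈ S.cell b) :
    freeEnergyDensity S.HS T (S.macroState a t) x = S.sysProb a t b * (S.sysVol b)⁻¹ *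
      (S.HS x + T * Real.log (S.sysProb a t b * (S.sysVol b)⁻¹)) := by
  have h : S.macroState a t x = S.sysProb a t b * (S.sysVol b)⁻¹ :=
    tsum_mul_boltzmannState S.partition.disjoint _ hx
  rw [freeEnergyDensity, h]

section Cell

variable {m : ℝ} {b : α} (hres : ∀ x ∈ S.cell b, ∀ y ∈ S.cell b, |S.HS x - S.HS y| ≤ m)

include hres in
theorem integrableOn_freeEnergyDensity_cell (T : ℝ) (a : α) (t : ℝ) :
    IntegrableOn (freeEnergyDensity S.HS T (S.macroState a t)) (S.cell b) (liouville ι S.h) := by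
  have h : IntegrableOn (fun x => S.sysProb a t b * (S.sysVol b)⁻¹ *
      (S.HS x + T * Real.log (S.sysProb a t b * (S.sysVol b)⁻¹))) (S.cell b) (liouville ι S.h) :=
    ((S.integrableOn_HS hres).add (integrableOn_const (S.partition.finite b))).const_mul _
  exact h.congr_fun (fun x hx => (S.freeEnergyDensity_macroState T a t hx).symm)
    (S.partition.measurable b)

theorem sysProb_eq_zero_of_sysVol_eq_zero (hb : S.sysVol b = 0) (a : α) (t : ℝ) :
    S.sysProb a t b = 0 := by
  by_contra h
  exact (S.sysVol_pos_of_cellVol_ne_zero (S.cellVol_ne_zero_of_sysProb_ne_zero h)).ne' hb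

include hres in
theorem setIntegral_freeEnergyDensity_cell (T : ℝ) (a : α) (t : ℝ) :
    ∫ x in S.cell b, freeEnergyDensity S.HS T (S.macroState a t) x ∂(liouville ι S.h) =
      S.cellFreeEnergy T a t b := by
  rw [setIntegral_congr_fun (S.partition.measurable b) fun x hx =>
    S.freeEnergyDensity_macroState T a t hx, cellFreeEnergy]
  by_cases hb : S.sysVol b = 0
  · simp [S.sysProb_eq_zero_of_sysVol_eq_zero hb]
  rw [integral_const_mul, integral_add (S.integrableOn_HS hres)
    (integrableOn_const (S.partition.finite b)), ← S.sysVol_mul_cellEnergy b hb, setIntegral_const,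
    smul_eq_mul]
  change _ * (_ + S.sysVol b * _) = _
  field_simp

-- On a cell the integrand varies only through `H_S`, hence little about its mean. This reduces
-- integrability on `Ω_S` to summability of the cell contributions.
include hres in
theorem setIntegral_norm_freeEnergyDensity_cell_le (T : ℝ) (a : α) (t : ℝ) :
    ∫ x in S.cell b, ‖freeEnergyDensity S.HS T (S.macroState a t) x‖ ∂(liouville ι S.h) ≤
      S.sysProb a t b * m + |S.cellFreeEnergy T a t b| := by
  have hp := S.sysProb_nonneg a t b
  rcases (S.sysVol_nonneg b).eq_or_lt with hb | hb
  · rw [setIntegral_congr_fun (S.partition.measurable b) fun x hx =>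
      congrArg norm (S.freeEnergyDensity_macroState T a t hx)]
    simp [S.sysProb_eq_zero_of_sysVol_eq_zero hb.symm]
  have hbound : ∀ x ∈ S.cell b, ‖‖freeEnergyDensity S.HS T (S.macroState a t) x‖‖ ≤
      (S.sysVol b)⁻¹ * (S.sysProb a t b * m + |S.cellFreeEnergy T a t b|) := by
    intro x hx
    rw [norm_norm, S.freeEnergyDensity_macroState T a t hx, Real.norm_eq_abs]
    have h1 : S.sysProb a t b * (S.sysVol b)⁻¹ *
        (S.HS x + T * Real.log (S.sysProb a t b * (S.sysVol b)⁻¹)) =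
        (S.sysVol b)⁻¹ * (S.sysProb a t b * (S.HS x - S.cellEnergy b) +
          S.cellFreeEnergy T a t b) := by
      rw [cellFreeEnergy]; ring
    rw [h1, abs_mul, abs_of_pos (inv_pos.2 hb)]
    refine mul_le_mul_of_nonneg_left ((abs_add_le _ _).trans ?_) (inv_pos.2 hb).le
    rw [abs_mul, abs_of_nonneg hp]
    gcongr
    exact S.abs_HS_sub_cellEnergy_le hres hb hx
  have h := norm_setIntegral_le_of_norm_le_const (S.partition.finite b).lt_top hbound
  refine (le_abs_self _).trans (h.trans (le_of_eq ?_))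
  change _ * S.sysVol b = _
  field_simp

end Cell

/-- Where `p ≠ 0`, writing `p = q f` splits `log (p / |B|)` into `log f + log (q / |B|)`; what
remains is the quantity controlled by the bath. -/
theorem cellFreeEnergy_sub_eq {T : ℝ} (hT : 0 < T) (a : α) (t : ℝ) (b : α) (K : ℝ) :
    S.cellFreeEnergy T a t b - T * (S.cellVol b * (S.visitDensity a t b *
        Real.log (S.visitDensity a t b)) + S.sysProb a t b * K) =
      T * (S.sysProb a t b *
        (Real.log (S.cellVol b / S.sysVol b) + S.cellEnergy b / T - K)) := by
  by_cases hp : S.sysProb a t b = 0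
  · have h0 : S.cellVol b * S.visitDensity a t b = 0 := by rw [cellVol_mul_visitDensity, hp]
    rw [cellFreeEnergy, hp, ← mul_assoc, h0]
    simp
  have hq := S.cellVol_ne_zero_of_sysProb_ne_zero hp
  have hv := (S.sysVol_pos_of_cellVol_ne_zero hq).ne'
  have hqf := S.cellVol_mul_visitDensity a t b
  have hf : S.visitDensity a t b ≠ 0 := fun h => hp (by rw [← hqf, h, mul_zero])
  have hlog : Real.log (S.sysProb a t b * (S.sysVol b)⁻¹) =
      Real.log (S.visitDensity a t b) + Real.log (S.cellVol b / S.sysVol b) := by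
    rw [← Real.log_mul hf (div_ne_zero hq hv), ← hqf]
    congr 1
    field_simp
  rw [cellFreeEnergy, hlog, ← mul_assoc (S.cellVol b), hqf]
  field_simp
  ring

variable {S} [Countable α] {T η : ℝ} {a : α}

/-- The free energy of a thermostated system is, up to a constant and a small error, the
coarse-grained negative entropy of system plus bath. -/
theorem IsThermostated.exists_abs_coarseFreeEnergy_sub_le (hS : S.IsThermostated T η a)
    (hT : 0 < T) (hη : 0 ≤ η) (hη' : η ≤ 1 / 32) (ha : S.cellVol a ≠ 0) :
    ∃ K : ℝ, ∀ t, 0 ≤ t →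
      IntegrableOn (freeEnergyDensity S.HS T (S.macroState a t)) S.ΩS (liouville ι S.h) ∧
      |S.coarseFreeEnergy T a t - T * (S.jointNegEntropy a t + K)| ≤ T * (33 * η) := by
  obtain ⟨K, hK⟩ := hS.exists_abs_log_cellVol_le hT hη hη'
  refine ⟨K, fun t ht => ?_⟩
  have hp := S.hasSum_sysProb ha t
  have hent : HasSum (fun b => S.cellVol b * (S.visitDensity a t b *
      Real.log (S.visitDensity a t b))) (S.jointNegEntropy a t) :=
    (summable_negEntropy S.cellVol_nonneg S.summable_cellVol (S.visitDensity_mem a t)).hasSum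
  have hmain := (hent.add (hp.mul_right K)).mul_left T
  rw [one_mul] at hmain
  have herr : ∀ b, |S.cellFreeEnergy T a t b - T * (S.cellVol b * (S.visitDensity a t b *
      Real.log (S.visitDensity a t b)) + S.sysProb a t b * K)| ≤
      T * (S.sysProb a t b * (33 * η)) := by
    intro b
    rw [S.cellFreeEnergy_sub_eq hT, abs_mul, abs_mul, abs_of_pos hT,
      abs_of_nonneg (S.sysProb_nonneg a t b)]
    by_cases h0 : S.sysProb a t b = 0
    · simp [h0]
    · gcongr
      · exact S.sysProb_nonneg a t b
      · exact hK b ⟨t, ht, h0⟩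
  have hbound := (hp.mul_right (33 * η)).mul_left T
  rw [one_mul] at hbound
  -- Summability of the free energy is not assumed: it follows from that of the entropy series and
  -- of an error dominated by `p`.
  have hdiff := Summable.of_norm_bounded (f := fun b => S.cellFreeEnergy T a t b -
    T * (S.cellVol b * (S.visitDensity a t b * Real.log (S.visitDensity a t b)) +
      S.sysProb a t b * K)) hbound.summable herr
  have hcell : Summable (S.cellFreeEnergy T a t) :=
    (hdiff.add hmain.summable).congr fun b => sub_add_cancel _ _
  have hint : IntegrableOn (freeEnergyDensity S.HS T (S.macroState a t)) S.ΩS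
      (liouville ι S.h) := by
    rw [← S.partition.iUnion]
    refine integrableOn_iUnion_of_summable_integral_norm
      (fun b => S.integrableOn_freeEnergyDensity_cell (hS.energy_resolved b) T a t) ?_
    exact Summable.of_nonneg_of_le (fun b => integral_nonneg fun x => norm_nonneg _)
      (fun b => S.setIntegral_norm_freeEnergyDensity_cell_le (hS.energy_resolved b) T a t)
      ((hp.summable.mul_right _).add hcell.abs)
  refine ⟨hint, ?_⟩
  rw [← S.partition.iUnion] at hint
  have hF := hasSum_integral_iUnion S.partition.measurable S.partition.disjoint hint
  rw [S.partition.iUnion] at hF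
  have hF' : HasSum (S.cellFreeEnergy T a t) (S.coarseFreeEnergy T a t) :=
    hF.congr_fun fun b =>
      (S.setIntegral_freeEnergyDensity_cell (hS.energy_resolved b) T a t).symm
  have hsub := hF'.sub hmain
  rw [abs_le]
  constructor
  · have := hasSum_le (fun b => (abs_le.1 (herr b)).1) hbound.neg hsub
    exact this
  · exact hasSum_le (fun b => (abs_le.1 (herr b)).2) hsub hbound

end SystemWithBath

end

theorem theorem5 :
    ∀ δ : ℝ, 0 < δ → ∃ η : ℝ, 0 < η ∧
      ∀ (ι κ α : Type) [Fintype ι] [Fintype κ] [DecidableEq ι] [DecidableEq κ] [Countable α]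
        (S : SystemWithBath ι κ α) (T : ℝ) (a : α), 0 < T →
        0 < S.ω (S.jointCell (a, 0)) → S.IsThermostated T η a →
        (∀ t, 0 ≤ t → IntegrableOn (freeEnergyDensity S.HS T (S.macroState a t)) S.ΩS
          (liouville ι S.h)) ∧
        (∀ t, 0 ≤ t → S.coarseFreeEnergy T a t ≤ S.coarseFreeEnergy T a 0 + δ * T) ∧
        (∀ τ₀, IsLocalMixingTime S.ω S.jointCell S.U τ₀ → ∀ t τ, τ₀ ≤ t → τ₀ ≤ τ →
          S.coarseFreeEnergy T a (t + τ) ≤ S.coarseFreeEnergy T a τ + δ * T) ∧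
        (IsLocallyMixing S.ω S.jointCell S.U → ∃ τ₀, 0 ≤ τ₀ ∧ ∀ t τ, τ₀ ≤ t → τ₀ ≤ τ →
          S.coarseFreeEnergy T a (t + τ) ≤ S.coarseFreeEnergy T a τ + δ * T) := by
  intro δ hδ
  -- Since `33 * (δ / 132) = δ / 4`, replacing `F` by the entropy at two times costs `δ T / 2`; the
  -- other half is left for the entropy increase allowed by asymptotic mixing.
  have hη : 0 < min (1 / 32) (δ / 132) := lt_min (by norm_num) (by positivity)
  refine ⟨min (1 / 32) (δ / 132), hη, ?_⟩
  intro ι κ α _ _ _ _ _ S T a hT hvol hS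
  have ha : S.cellVol a ≠ 0 := (ENNReal.toReal_pos hvol.ne'
    (S.measure_ne_top_of_subset_shell (S.shellCell_subset_shell a))).ne'
  obtain ⟨K, hK⟩ := hS.exists_abs_coarseFreeEnergy_sub_le hT hη.le (min_le_left _ _) ha
  have hηδ : 33 * min (1 / 32) (δ / 132) ≤ δ / 4 := by
    have := min_le_right (1 / 32) (δ / 132)
    linarith
  have hle : ∀ s t, 0 ≤ s → 0 ≤ t → S.jointNegEntropy a s ≤ S.jointNegEntropy a t + δ / 2 →
      S.coarseFreeEnergy T a s ≤ S.coarseFreeEnergy T a t + δ * T := by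
    intro s t hs ht hst
    have h1 := (abs_le.1 (hK s hs).2).2
    have h2 := (abs_le.1 (hK t ht).2).1
    have h3 := mul_le_mul_of_nonneg_left hηδ hT.le
    have h4 := mul_le_mul_of_nonneg_left hst hT.le
    linarith
  refine ⟨fun t ht => (hK t ht).1, fun t ht => ?_, fun τ₀ hmix t τ ht hτ => ?_, fun hmix => ?_⟩
  · refine hle t 0 ht le_rfl ?_
    linarith [S.jointNegEntropy_le_zero ha t]
  · have h0 := hmix.1
    refine hle (t + τ) τ (by linarith) (by linarith) ?_
    linarith [S.jointNegEntropy_add_le hmix a ht hτ]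
  · obtain ⟨τ₀, h0, h⟩ := S.exists_jointNegEntropy_add_le hmix a (half_pos hδ)
    exact ⟨τ₀, h0, fun t τ ht hτ => hle (t + τ) τ (by linarith) (by linarith) (h t τ ht hτ)⟩
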